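/- **Setting.** Let $\{Z_t\}_{t\in\mathbb Z}$ be i.i.d. real random variables with mean $0$ and variance $1$, let $\theta,\gamma\in\mathbb R$ be not both zero, and put $g(Z_t)=\theta Z_t+\gamma\,(|Z_t|-\mathbb E|Z_t|)$ and $\sigma_g^2=\mathrm{Var}(g(Z_0))$. Let $\alpha,\beta$ be real polynomials without common complex roots, with $\alpha(0)=\beta(0)=1$ and $\beta(z)\ne0$ for $|z|\le1$; let $s\ge1$ be an integer, $\omega\in\mathbb R$ and $d<\tfrac12$. Define, for $|z|<1$, $$(1-z^s)^{-d}=\sum_{k\ge0}\pi_{d,k}z^k,\qquad f(z)=\frac{\alpha(z)}{\beta(z)}=\sum_{k\ge0}f_kz^k,\qquad \frac{\alpha(z)}{\beta(z)}(1-z^s)^{-d}=\sum_{k\ge0}\lambda_{d,k}z^k .$$ Let $\{X_t\}_{t\in\mathbb Z}$ be the seasonal FIEGARCH process $X_t=\sigma_tZ_t$, where $\sigma_t>0$ almost surely and $\ln(\sigma_t^2)=\omega+\sum_{k=0}^\infty\lambda_{d,k}\,g(Z_{t-1-k})$ (the series converging almost surely) for all $t\in\mathbb Z$. For $h\in\mathbb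 Z$ put $\gamma_A(h)=\sum_{i\ge0}f_if_{i+|h|}$ and $$\gamma_V(sh)=\sigma_g^2\,\frac{(-1)^h\,\Gamma(1-2d)}{\Gamma(1-d+h)\,\Gamma(1-d-h)},\qquad 1/\Gamma:=0\text{ at the poles of }\Gamma .$$ For $h,k\in\mathbb N$ and $r\in\{0,\dots,s-1\}$ put $$\mathcal G(sh+r)=\sum_{|k|\le\lfloor\sqrt h\rfloor}\gamma_A(sk+r)\,\frac{\gamma_V(sh-sk)}{\gamma_V(sh)},\qquad \mathcal K(sk+r)=\sum_{j=0}^{\lfloor\sqrt k\rfloor}f_{sj+r}\,\frac{\pi_{d,sk-sj}}{\pi_{d,sk}},$$ where the quotients are read with the common factors cancelled, i.e. as $\frac{\Gamma(h-k+d)\,\Gamma(h+1-d)}{\Gamma(h-k+1-d)\,\Gamma(h+d)}$ and $\frac{\Gamma(k-j+d)\,\Gamma(k+1)}{\Gamma(k-j+1)\,\Gamma(k+d)}$ respectively; for large $h$, $k$ these make sense also when $d$ is a non-positive integer or $\sigma_g^2=0$. **Theorem.** Suppose in addition that $\ln(Z_0^2)$ is almost surely finite (that is, $\mathbb P(Z_0=0)=0$)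 and $\mathrm{Var}(\ln(Z_0^2))=:\sigma^2_{\ln Z^2}<\infty$. Let $C_1=\mathrm{Cov}(g(Z_0),\ln(Z_0^2))$. Then $\{\ln(\sigma_t^2)\}$ and $\{\ln(X_t^2)\}$ are weakly stationary, and their autocovariance functions $\gamma_{\ln\sigma^2}$ and $\gamma_{\ln X^2}$ satisfy $$\gamma_{\ln X^2}(h)=\gamma_{\ln\sigma^2}(h)+C_1\lambda_{d,|h|-1}\mathbf 1\{h\ne0\}+\sigma^2_{\ln Z^2}\mathbf 1\{h=0\}\qquad(h\in\mathbb Z),$$ $$\gamma_{\ln\sigma^2}(sh+r)=\sum_{k\in\mathbb Z}\gamma_A(sk+r)\,\gamma_V(sh-sk)\qquad(h\in\mathbb Z,\ 0\le r\le s-1).$$ Moreover, for every $\nu>0$ and every $r\in\{0,\dots,s-1\}$, as $h\to\infty$, $$\gamma_{\ln X^2}(sh+r)=\gamma_V(sh)\,\mathcal G(sh+r)+C_1\,\pi_{d,s\lfloor(sh+r-1)/s\rfloor}\,\mathcal K(sh+r-1)+o(h^{-\nu}).$$ Here $\mathcal G$ and $\mathcal K$ satisfy, for every $\nu>0$ and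 $r\in\{0,\dots,s-1\}$, as $h\to\infty$, $$\gamma_{\ln\sigma^2}(sh+r)=\gamma_V(sh)\,\mathcal G(sh+r)+o(h^{-\nu}),\qquad \lambda_{d,sh+r}=\pi_{d,sh}\,\mathcal K(sh+r)+o(h^{-\nu}),$$ $$\lim_{h\to\infty}\sum_{r=0}^{s-1}\mathcal G(sh+r)=\sum_{k\in\mathbb Z}\gamma_A(k),\qquad \lim_{h\to\infty}\sum_{r=0}^{s-1}\mathcal K(sh+r)=\frac{\alpha(1)}{\beta(1)},$$ the series $\sum_{k\in\mathbb Z}\gamma_A(k)$ being absolutely convergent. -/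

import Mathlib

open MeasureTheory ProbabilityTheory Filter Topology Asymptotics

noncomputable section

namespace SFIEGARCH

/-! ### Coefficient sequences -/

/-- The Maclaurin coefficient `Γ(k+d) / (Γ(k+1) Γ(d))` of `y ^ k` in `(1 - y)^(-d)`, written as
`d (d+1) ⋯ (d+k-1) / k!` so that it is also meaningful when `d` is a non-positive integer. -/
def fracCoeff (d : ℝ) (k : ℕ) : ℝ := (ascPochhammer ℝ k).eval d / (k.factorial : ℝ)

/-- `π_{d,k}`: the coefficient of `z ^ k` in `(1 - z ^ s)^(-d)`. -/
def seasCoeff (s : ℕ) (d : ℝ) (k : ℕ) : ℝ := if s ∣ k then fracCoeff d (k / s) else 0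

/-- `f_k`: the coefficient of `z ^ k` in `α(z) / β(z)`. -/
def armaCoeff (α β : Polynomial ℝ) (k : ℕ) : ℝ :=
  PowerSeries.coeff k ((α : PowerSeries ℝ) * (β : PowerSeries ℝ)⁻¹)

/-- `λ_{d,k}`: the coefficient of `z ^ k` in `(α(z) / β(z)) (1 - z ^ s)^(-d)`. -/
def lamCoeff (α β : Polynomial ℝ) (s : ℕ) (d : ℝ) (k : ℕ) : ℝ :=
  PowerSeries.coeff k
    ((α : PowerSeries ℝ) * (β : PowerSeries ℝ)⁻¹ * PowerSeries.mk (seasCoeff s d))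

/-- `γ_A(m) = ∑_{i ≥ 0} f_i f_{i+|m|}`. -/
def gammaA (α β : Polynomial ℝ) (m : ℤ) : ℝ :=
  ∑' i : ℕ, armaCoeff α β i * armaCoeff α β (i + m.natAbs)

/-- `γ_V`, with `v` in the role of the variance of the noise:
`γ_V(s h) = v (-1)^h Γ(1-2d) / (Γ(1-d+h) Γ(1-d-h))`, and `γ_V(m) = 0` if `s ∤ m`.
Where a Gamma function in the denominator has a pole, the value is `0` (`1 / Γ` vanishes there):
in Mathlib `Γ` takes the value `0` at its poles and `x / 0 = 0`. -/
def gammaV (s : ℕ) (d v : ℝ) (m : ℤ) : ℝ :=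
  if (s : ℤ) ∣ m then
    v * ((-1 : ℝ) ^ (m / (s : ℤ)) * Real.Gamma (1 - 2 * d) /
      (Real.Gamma (1 - d + ((m / (s : ℤ) : ℤ) : ℝ)) *
        Real.Gamma (1 - d - ((m / (s : ℤ) : ℤ) : ℝ))))
  else 0

/-- The function `𝒦`, where `k = ⌊n/s⌋` and `r = n mod s`:
`𝒦(sk+r) = ∑_{j=0}^{⌊√k⌋} f_{sj+r} π_{d,sk-sj} / π_{d,sk}`, the ratio being written with the common
factor `1 / Γ(d)` cancelled, so that it also makes sense if `d` is a non-positive integer. -/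
def scrK (α β : Polynomial ℝ) (s : ℕ) (d : ℝ) (n : ℕ) : ℝ :=
  ∑ j ∈ Finset.range (Nat.sqrt (n / s) + 1),
    armaCoeff α β (s * j + n % s) *
      (Real.Gamma (((n / s : ℕ) : ℝ) - j + d) * Real.Gamma (((n / s : ℕ) : ℝ) + 1) /
        (Real.Gamma (((n / s : ℕ) : ℝ) - j + 1) * Real.Gamma (((n / s : ℕ) : ℝ) + d)))

/-- The function `𝒢`, where `h = ⌊n/s⌋` and `r = n mod s`:
`𝒢(sh+r) = ∑_{|k| ≤ ⌊√h⌋} γ_A(sk+r) γ_V(sh-sk) / γ_V(sh)`, the ratio being written with the common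
factor of numerator and denominator cancelled, using `γ_V(sh) = c Γ(h+d) / Γ(h+1-d)`. -/
def scrG (α β : Polynomial ℝ) (s : ℕ) (d : ℝ) (n : ℕ) : ℝ :=
  ∑ k ∈ Finset.Icc (-((Nat.sqrt (n / s) : ℕ) : ℤ)) ((Nat.sqrt (n / s) : ℕ) : ℤ),
    gammaA α β ((s : ℤ) * k + ((n % s : ℕ) : ℤ)) *
      (Real.Gamma (((n / s : ℕ) : ℝ) - k + d) * Real.Gamma (((n / s : ℕ) : ℝ) + 1 - d) /
        (Real.Gamma (((n / s : ℕ) : ℝ) - k + 1 - d) * Real.Gamma (((n / s : ℕ) : ℝ) + d)))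

/-! ### Consistency with the quotients `π_{d,sk-sj} / π_{d,sk}` and `γ_V(sh-sk) / γ_V(sh)` -/

theorem fracCoeff_eq (d : ℝ) (hd : ∀ m : ℕ, d ≠ -(m : ℝ)) (k : ℕ) :
    fracCoeff d k = Real.Gamma (k + d) / (Real.Gamma (k + 1) * Real.Gamma d) := by
  have h0 : Real.Gamma d ≠ 0 := Real.Gamma_ne_zero hd
  have key : Real.Gamma (k + d) = (ascPochhammer ℝ k).eval d * Real.Gamma d := by
    induction k with
    | zero => simp
    | succ k ih =>
      have hk : (k : ℝ) + d ≠ 0 := fun h => hd k (by linarith)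
      rw [ascPochhammer_succ_eval]
      push_cast
      rw [show (k : ℝ) + 1 + d = (k + d) + 1 by ring, Real.Gamma_add_one hk, ih]
      ring
  rw [key, Real.Gamma_nat_eq_factorial, fracCoeff, mul_div_mul_right _ _ h0]

theorem scrK_eq (α β : Polynomial ℝ) (s : ℕ) (hs : 0 < s) (d : ℝ) (hd : ∀ m : ℕ, d ≠ -(m : ℝ))
    (k r : ℕ) (hr : r < s) :
    scrK α β s d (s * k + r) = ∑ j ∈ Finset.range (Nat.sqrt k + 1),
      armaCoeff α β (s * j + r) * (seasCoeff s d (s * k - s * j) / seasCoeff s d (s * k)) := by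
  have h1 : (s * k + r) / s = k := by
    rw [Nat.mul_add_div hs, Nat.div_eq_of_lt hr, Nat.add_zero]
  have h2 : (s * k + r) % s = r := by rw [Nat.mul_add_mod, Nat.mod_eq_of_lt hr]
  have hc : ∀ m : ℕ, seasCoeff s d (s * m) = fracCoeff d m := fun m => by
    simp [seasCoeff, Nat.mul_div_cancel_left m hs]
  rw [scrK, h1, h2]
  refine Finset.sum_congr rfl fun j hj => ?_
  have hjk : j ≤ k := by
    have := Finset.mem_range.1 hj
    have := Nat.sqrt_le_self k
    omega
  rw [← Nat.mul_sub, hc, hc, fracCoeff_eq d hd, fracCoeff_eq d hd]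
  have h0 : Real.Gamma d ≠ 0 := Real.Gamma_ne_zero hd
  have h3 : Real.Gamma ((k : ℝ) + 1) ≠ 0 := (Real.Gamma_pos_of_pos (by positivity)).ne'
  have h4 : Real.Gamma ((k : ℝ) + d) ≠ 0 := by
    refine Real.Gamma_ne_zero fun m hm => hd (k + m) ?_
    push_cast
    linarith
  have h5 : Real.Gamma (((k - j : ℕ) : ℝ) + 1) ≠ 0 :=
    (Real.Gamma_pos_of_pos (by positivity)).ne'
  rw [Nat.cast_sub hjk] at h5 ⊢
  field_simp

theorem gammaV_eq (s : ℕ) (hs : 0 < s) (d v : ℝ) (hd : ∀ m : ℤ, d ≠ m) (m : ℤ) :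
    gammaV s d v ((s : ℤ) * m) =
      (v * Real.Gamma (1 - 2 * d) / (Real.Gamma (1 - d) * Real.Gamma d)) *
        (Real.Gamma (m + d) / Real.Gamma (m + 1 - d)) := by
  have hs' : (s : ℤ) ≠ 0 := by omega
  have hg : ∀ (a : ℝ), (∀ n : ℤ, a ≠ n) → Real.Gamma a ≠ 0 := fun a ha =>
    Real.Gamma_ne_zero fun n hn => ha (-n) (by push_cast; exact hn)
  have e1 := Real.Gamma_mul_Gamma_one_sub d
  have e2 := Real.Gamma_mul_Gamma_one_sub (d + m)
  rw [mul_add, mul_comm Real.pi (m : ℝ), Real.sin_add_int_mul_pi] at e2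
  have n1 : Real.Gamma d ≠ 0 := hg _ hd
  have n2 : Real.Gamma (1 - d) ≠ 0 := hg _ fun n hn => hd (1 - n) (by push_cast; linarith)
  have n3 : Real.Gamma (d + m) ≠ 0 := hg _ fun n hn => hd (n - m) (by push_cast; linarith)
  have n4 : Real.Gamma (1 - (d + m)) ≠ 0 :=
    hg _ fun n hn => hd (1 - m - n) (by push_cast; linarith)
  have n5 : Real.Gamma (1 - d + m) ≠ 0 :=
    hg _ fun n hn => hd (1 + m - n) (by push_cast; linarith)
  have hm : ((-1 : ℝ) ^ m) * (-1 : ℝ) ^ m = 1 := by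
    rw [← mul_zpow]; simp
  have hm0 : ((-1 : ℝ) ^ m) ≠ 0 := zpow_ne_zero _ (by norm_num)
  have e3 : (-1 : ℝ) ^ m * (Real.Gamma d * Real.Gamma (1 - d)) =
      Real.Gamma (d + m) * Real.Gamma (1 - (d + m)) := by
    rw [e1, e2, ← div_div, div_right_comm, div_eq_mul_inv _ ((-1 : ℝ) ^ m),
      ← eq_inv_of_mul_eq_one_left hm]
    ring
  have : (s : ℤ) * m / (s : ℤ) = m := Int.mul_ediv_cancel_left m hs'
  rw [gammaV, if_pos (dvd_mul_right _ _), this,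
    show (m : ℝ) + d = d + m by ring, show (m : ℝ) + 1 - d = 1 - d + m by ring,
    show 1 - d - (m : ℝ) = 1 - (d + m) by ring]
  generalize Real.Gamma (1 - 2 * d) = a0 at *
  generalize Real.Gamma (d + m) = a3 at *
  generalize Real.Gamma (1 - (d + m)) = a4 at *
  generalize Real.Gamma (1 - d + m) = a5 at *
  generalize Real.Gamma (1 - d) = a2 at *
  generalize Real.Gamma d = a1 at *
  field_simp
  linear_combination v * a0 * e3

theorem scrG_eq (α β : Polynomial ℝ) (s : ℕ) (hs : 0 < s) (d v : ℝ) (hd : ∀ m : ℤ, d ≠ m)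
    (hd2 : d < 1 / 2) (hv : v ≠ 0) (h r : ℕ) (hr : r < s) :
    scrG α β s d (s * h + r) =
      ∑ k ∈ Finset.Icc (-((Nat.sqrt h : ℕ) : ℤ)) ((Nat.sqrt h : ℕ) : ℤ),
        gammaA α β ((s : ℤ) * k + (r : ℤ)) *
          (gammaV s d v ((s : ℤ) * h - (s : ℤ) * k) / gammaV s d v ((s : ℤ) * h)) := by
  have h1 : (s * h + r) / s = h := by
    rw [Nat.mul_add_div hs, Nat.div_eq_of_lt hr, Nat.add_zero]
  have h2 : (s * h + r) % s = r := by rw [Nat.mul_add_mod, Nat.mod_eq_of_lt hr]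
  have hg : ∀ (a : ℝ), (∀ n : ℤ, a ≠ n) → Real.Gamma a ≠ 0 := fun a ha =>
    Real.Gamma_ne_zero fun n hn => ha (-n) (by push_cast; exact hn)
  rw [scrG, h1, h2]
  refine Finset.sum_congr rfl fun k _ => ?_
  rw [← mul_sub, gammaV_eq s hs d v hd, gammaV_eq s hs d v hd]
  have n0 : Real.Gamma (1 - 2 * d) ≠ 0 := (Real.Gamma_pos_of_pos (by linarith)).ne'
  have n1 : Real.Gamma d ≠ 0 := hg _ hd
  have n2 : Real.Gamma (1 - d) ≠ 0 := hg _ fun n hn => hd (1 - n) (by push_cast; linarith)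
  have n3 : Real.Gamma ((h : ℝ) + d) ≠ 0 := hg _ fun n hn => hd (n - h) (by push_cast; linarith)
  have n4 : Real.Gamma ((h : ℝ) + 1 - d) ≠ 0 :=
    hg _ fun n hn => hd (h + 1 - n) (by push_cast; linarith)
  have n5 : Real.Gamma ((h : ℝ) - k + 1 - d) ≠ 0 :=
    hg _ fun n hn => hd (h - k + 1 - n) (by push_cast; linarith)
  push_cast
  generalize Real.Gamma (1 - 2 * d) = a0 at *
  generalize Real.Gamma ((h : ℝ) + d) = a3 at *
  generalize Real.Gamma ((h : ℝ) + 1 - d) = a4 at *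
  generalize Real.Gamma ((h : ℝ) - k + 1 - d) = a5 at *
  generalize Real.Gamma ((h : ℝ) - k + d) = a6 at *
  generalize Real.Gamma (1 - d) = a2 at *
  generalize Real.Gamma d = a1 at *
  field_simp

/-! ### The process -/

variable {Ω : Type*} [MeasurableSpace Ω]

/-- `g(Z_t) = θ Z_t + γ (|Z_t| - E|Z_t|)`. -/
def gZ (P : Measure Ω) (Z : ℤ → Ω → ℝ) (θ γ : ℝ) (t : ℤ) (x : Ω) : ℝ :=
  θ * Z t x + γ * (|Z t x| - ∫ y, |Z t y| ∂P)

/-- `X` is a seasonal FIEGARCH process with polynomials `α`, `β`, season length `s`, differencing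
parameter `d`, level `ω` and parameters `θ`, `γ` of `g`; the noise is `Z`, the volatility `σ`. -/
structure IsSFIEGARCH (P : Measure Ω) (α β : Polynomial ℝ) (s : ℕ) (d ω θ γ : ℝ)
    (Z σ X : ℤ → Ω → ℝ) : Prop where
  s_pos : 0 < s
  coeff_zero_alpha : α.coeff 0 = 1
  coeff_zero_beta : β.coeff 0 = 1
  no_common_root : ∀ z : ℂ, ¬ (Polynomial.aeval z α = 0 ∧ Polynomial.aeval z β = 0)
  beta_ne_zero : ∀ z : ℂ, ‖z‖ ≤ 1 → Polynomial.aeval z β ≠ 0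
  measurable_Z : ∀ t, Measurable (Z t)
  indep_Z : iIndepFun Z P
  ident_Z : ∀ t, IdentDistrib (Z t) (Z 0) P P
  memLp_Z : MemLp (Z 0) 2 P
  mean_Z : ∫ x, Z 0 x ∂P = 0
  var_Z : variance (Z 0) P = 1
  measurable_sigma : ∀ t, Measurable (σ t)
  sigma_pos : ∀ t, ∀ᵐ x ∂P, 0 < σ t x
  /-- `ln σ_t² = ω + ∑_{k ≥ 0} λ_{d,k} g(Z_{t-1-k})`, the series converging almost surely. -/
  log_sigma_sq : ∀ t, ∀ᵐ x ∂P,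
    Tendsto (fun n : ℕ => ω + ∑ k ∈ Finset.range n,
        lamCoeff α β s d k * gZ P Z θ γ (t - 1 - (k : ℤ)) x)
      atTop (𝓝 (Real.log (σ t x ^ 2)))
  X_eq : ∀ t, ∀ᵐ x ∂P, X t x = σ t x * Z t x

/-- The process `ln(Y_t²)`. -/
def logSq (Y : ℤ → Ω → ℝ) (t : ℤ) (x : Ω) : ℝ := Real.log (Y t x ^ 2)

/-- Weak stationarity: finite second moments, constant mean, and `Cov(Y_t, Y_{t+h})` depends on `h`
only. -/
structure IsWeaklyStationary (P : Measure Ω) (Y : ℤ → Ω → ℝ) : Prop where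
  memLp : ∀ t, MemLp (Y t) 2 P
  mean : ∀ t, ∫ x, Y t x ∂P = ∫ x, Y 0 x ∂P
  cov : ∀ t h, covariance (Y t) (Y (t + h)) P = covariance (Y 0) (Y h) P

/-- The autocovariance function `h ↦ Cov(Y_0, Y_h)` of a weakly stationary process. -/
def acvf (P : Measure Ω) (Y : ℤ → Ω → ℝ) (h : ℤ) : ℝ := covariance (Y 0) (Y h) P

end SFIEGARCH

end

noncomputable section

namespace SFIEGARCH

/-! ### Asymptotics of quotients of Gamma functions -/

/-! Almost surely `ln X_t² = ln σ_t² + ln Z_t²`, and `ln σ_t² - ω` is an orthogonal series in the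
centred variables `g(Z_{t-1-k})` with square-summable coefficients `λ_{d,k}`. Its almost sure limit
is therefore its `L²` sum (`orthogonal_series_ae_limit`), and covariances can be taken term by term.
Against `ln Z_u²` only the term `k = t-1-u` survives, which gives `C_1 λ_{d,|h|-1}`; against another
`ln σ²` one gets `σ_g² ∑ λ_{d,k} λ_{d,k+h}`.

Since `λ` is the convolution of `f` and `π_d`, its autocorrelation is the convolution of the two
autocorrelations (`exists_hasSum_autocov_convolution`). That of `f` is `γ_A`; that of `π_d` is `γ_V`
with unit noise variance, by Gauss's formula for `₂F₁` at `1` (`tsum_gaussTerm`,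
`hasSum_seasCoeff_mul`). As `π_d` and `γ_V` vanish off the multiples of `s`, only one residue class
of indices contributes.

For the asymptotics, `β` has no zero in the closed disc, so `f` and `γ_A` decay geometrically.
Cutting the convolution at `⌊√h⌋` costs `O(τ^⌊√h⌋)` with `τ < 1`, which beats every power of `h`
(`sub_truncated_isLittleO`). Inside the window the slowly varying factor is a constant times a
quotient of Gamma functions, so its value at `h` factors out exactly (`eventually_truncated_eq`) and
leaves `𝒢` or `𝒦`. The remaining quotients are bounded and tend to `1`, so dominated convergence
gives the limits (`tendsto_sum_window`). -/

theorem Gamma_add_nat_eq_prod {a : ℝ} (ha : 0 < a) (n : ℕ) :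
    Real.Gamma (n + a) = (∏ j ∈ Finset.range n, (a + j)) * Real.Gamma a := by
  induction n with
  | zero => simp
  | succ n ih =>
    have : (n : ℝ) + a ≠ 0 := by positivity
    rw [Finset.prod_range_succ, Nat.cast_succ, show (n : ℝ) + 1 + a = n + a + 1 by ring,
      Real.Gamma_add_one this, ih]
    ring

/-- Euler's limit for `Γ(a)`, whose denominator `a (a+1) ⋯ (a+n)` is `Γ(n+1+a) / Γ(a)`. -/
theorem tendsto_Gamma_nat_add_of_pos {a : ℝ} (ha : 0 < a) :
    Tendsto (fun n : ℕ => Real.Gamma (n + (a + 1)) / (n.factorial * (n : ℝ) ^ a)) atTop (𝓝 1) := by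
  have h0 : Real.Gamma a ≠ 0 := (Real.Gamma_pos_of_pos ha).ne'
  have h := (tendsto_const_nhds (x := Real.Gamma a)).div (Real.GammaSeq_tendsto_Gamma a) h0
  rw [div_self h0] at h
  refine h.congr' (.of_forall fun n => ?_)
  have := Gamma_add_nat_eq_prod ha (n + 1)
  rw [show (((n + 1 : ℕ) : ℝ)) + a = n + (a + 1) by push_cast; ring] at this
  change Real.Gamma a / Real.GammaSeq a n = Real.Gamma (n + (a + 1)) / (n.factorial * (n : ℝ) ^ a)
  rw [this, Real.GammaSeq, div_div_eq_mul_div]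
  ring

theorem tendsto_Gamma_nat_add (a : ℝ) :
    Tendsto (fun n : ℕ => Real.Gamma (n + a) / (n.factorial * (n : ℝ) ^ (a - 1))) atTop
      (𝓝 1) := by
  -- The range `a > 1` is known. The functional equation lowers `a` by one at the cost of a factor
  -- `1 + a/n → 1`, so induction on `N` reaches every real `a`.
  obtain ⟨N, hN⟩ := exists_nat_gt (1 - a)
  induction N generalizing a with
  | zero =>
    have h := tendsto_Gamma_nat_add_of_pos (a := a - 1) (by simp at hN; linarith)
    simpa using h
  | succ N ih =>
    have h1 := ih (a + 1) (by push_cast at hN; linarith)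
    have h2 : Tendsto (fun n : ℕ => (1 + a / (n : ℝ))) atTop (𝓝 1) := by
      simpa using (tendsto_const_nhds (x := (1 : ℝ))).add (tendsto_const_div_atTop_nhds_zero_nat a)
    have h3 := h1.div h2 one_ne_zero
    rw [div_one] at h3
    refine h3.congr' ?_
    obtain ⟨M, hM⟩ := exists_nat_gt |a|
    filter_upwards [eventually_ge_atTop (max M 1)] with n hn
    have hn1 : (1 : ℝ) ≤ n := by exact_mod_cast (le_max_right _ _).trans hn
    have hn2 : |a| < n := hM.trans_le (by exact_mod_cast (le_max_left _ _).trans hn)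
    have hn0 : (n : ℝ) ≠ 0 := by positivity
    have hna : (n : ℝ) + a ≠ 0 := by
      have := neg_abs_le a
      exact ne_of_gt (by linarith)
    have e : (n : ℝ) ^ (a + 1 - 1) = n ^ (a - 1) * n := by
      rw [← Real.rpow_add_one hn0]; ring_nf
    have h4 : (n : ℝ) ^ (a - 1) ≠ 0 := by positivity
    have h5 : (n.factorial : ℝ) ≠ 0 := by positivity
    have h6 : (1 + a / (n : ℝ)) = (n + a) / n := by field_simp
    rw [Pi.div_apply, h6, e, show (n : ℝ) + (a + 1) = n + a + 1 by ring, Real.Gamma_add_one hna]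
    field_simp

/-- The quotient `Γ(n+a) / Γ(n+b)`. -/
def gammaRatio (a b x : ℝ) : ℝ := Real.Gamma (x + a) / Real.Gamma (x + b)

theorem gammaRatio_pos {a b x : ℝ} (ha : 0 < x + a) (hb : 0 < x + b) : 0 < gammaRatio a b x :=
  div_pos (Real.Gamma_pos_of_pos ha) (Real.Gamma_pos_of_pos hb)

theorem tendsto_gammaRatio (a b : ℝ) :
    Tendsto (fun n : ℕ => gammaRatio a b n / (n : ℝ) ^ (a - b)) atTop (𝓝 1) := by
  have h := (tendsto_Gamma_nat_add a).div (tendsto_Gamma_nat_add b) one_ne_zero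
  rw [div_one] at h
  refine h.congr' ?_
  filter_upwards [eventually_ge_atTop 1] with n hn
  have hn1 : (1 : ℝ) ≤ n := by exact_mod_cast hn
  have e : (n : ℝ) ^ (a - b) = n ^ (a - 1) / n ^ (b - 1) := by
    rw [← Real.rpow_sub (by positivity)]; ring_nf
  have h4 : (n : ℝ) ^ (a - 1) ≠ 0 := by positivity
  have h4' : (n : ℝ) ^ (b - 1) ≠ 0 := by positivity
  have h5 : (n.factorial : ℝ) ≠ 0 := by positivity
  rw [Pi.div_apply, e, gammaRatio]
  by_cases h0 : Real.Gamma (n + b) = 0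
  · simp [h0]
  field_simp

/-- Above the poles, `(d)_n` is a multiple of `Γ(n+d)`. -/
theorem exists_ascPochhammer_eq (d : ℝ) :
    ∃ κ : ℝ, ∀ n : ℕ, 0 < (n : ℝ) + d → (ascPochhammer ℝ n).eval d = κ * Real.Gamma (n + d) := by
  by_cases hd : ∀ m : ℕ, d ≠ -(m : ℝ)
  · refine ⟨(Real.Gamma d)⁻¹, fun n _ => ?_⟩
    have h := fracCoeff_eq d hd n
    have h5 : (n.factorial : ℝ) ≠ 0 := by positivity
    have h0 : Real.Gamma d ≠ 0 := Real.Gamma_ne_zero hd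
    rw [fracCoeff, Real.Gamma_nat_eq_factorial] at h
    field_simp at h ⊢
    linarith
  · push Not at hd
    obtain ⟨m, rfl⟩ := hd
    -- For `d = -m` the product `(d)_n` contains the factor `0` as soon as `n > m`.
    refine ⟨0, fun n hn => ?_⟩
    have : m < n := by
      have : (m : ℝ) < n := by linarith
      exact_mod_cast this
    rw [zero_mul, ascPochhammer_eval_neg_coe_nat_of_lt this]

theorem exists_fracCoeff_eq (d : ℝ) :
    ∃ κ : ℝ, ∀ n : ℕ, 0 < (n : ℝ) + d → fracCoeff d n = κ * gammaRatio d 1 n := by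
  obtain ⟨κ, h⟩ := exists_ascPochhammer_eq d
  refine ⟨κ, fun n hn => ?_⟩
  rw [fracCoeff, h n hn, gammaRatio, Real.Gamma_nat_eq_factorial, mul_div_assoc]

theorem eventually_nat_add_pos (d : ℝ) : ∀ᶠ n : ℕ in atTop, 0 < (n : ℝ) + d := by
  filter_upwards [tendsto_natCast_atTop_atTop.eventually_gt_atTop (-d)] with n hn
  linarith

theorem gammaRatio_isTheta (a b : ℝ) :
    (fun n : ℕ => gammaRatio a b n) =Θ[atTop] fun n : ℕ => (n : ℝ) ^ (a - b) := by
  refine IsEquivalent.isTheta ?_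
  refine (isEquivalent_iff_tendsto_one ?_).2 (tendsto_gammaRatio a b)
  filter_upwards [eventually_ge_atTop 1] with n hn
  have : (1 : ℝ) ≤ n := by exact_mod_cast hn
  positivity

theorem fracCoeff_isBigO (d : ℝ) :
    (fracCoeff d) =O[atTop] fun n : ℕ => (n : ℝ) ^ (d - 1) := by
  obtain ⟨κ, h⟩ := exists_fracCoeff_eq d
  refine IsBigO.congr' ((gammaRatio_isTheta d 1).1.const_mul_left κ) ?_ EventuallyEq.rfl
  filter_upwards [eventually_nat_add_pos d] with n hn
  rw [h n hn]

theorem fracCoeff_inv_isBigO {c : ℝ} (hc : 0 < c) :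
    (fun n => (fracCoeff c n)⁻¹) =O[atTop] fun n : ℕ => (n : ℝ) ^ (1 - c) := by
  have hc' : ∀ m : ℕ, c ≠ -(m : ℝ) := fun m => by
    have : (0 : ℝ) ≤ m := by positivity
    exact ne_of_gt (by linarith)
  have h := ((gammaRatio_isTheta 1 c).1.const_mul_left (Real.Gamma c))
  refine h.congr (fun n => ?_) fun n => rfl
  rw [fracCoeff_eq c hc', gammaRatio]
  simp only [inv_div]
  ring

/-! ### Gauss's summation formula -/

/-- The terms of the hypergeometric series `₂F₁(a, b; c; 1)`. -/
def gaussTerm (a b c : ℝ) (n : ℕ) : ℝ :=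
  (ascPochhammer ℝ n).eval a * (ascPochhammer ℝ n).eval b /
    ((ascPochhammer ℝ n).eval c * n.factorial)

theorem ascPochhammer_succ_eval_left (x : ℝ) (n : ℕ) :
    (ascPochhammer ℝ (n + 1)).eval x = x * (ascPochhammer ℝ n).eval (x + 1) := by
  rw [ascPochhammer_succ_left]
  simp [Polynomial.eval_comp]

theorem one_le_ascPochhammer_eval {x : ℝ} (hx : 1 ≤ x) (n : ℕ) :
    1 ≤ (ascPochhammer ℝ n).eval x := by
  induction n with
  | zero => simp
  | succ n ih =>
    rw [ascPochhammer_succ_eval]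
    have : (0 : ℝ) ≤ n := by positivity
    exact one_le_mul_of_one_le_of_one_le ih (by linarith)

theorem ascPochhammer_add_eval (x : ℝ) (n m : ℕ) :
    (ascPochhammer ℝ (n + m)).eval x =
      (ascPochhammer ℝ n).eval x * (ascPochhammer ℝ m).eval (x + n) := by
  induction m with
  | zero => simp
  | succ m ih =>
    rw [← add_assoc, ascPochhammer_succ_eval, ih, ascPochhammer_succ_eval]
    push_cast
    ring

theorem gaussTerm_eq_fracCoeff (a b c : ℝ) (n : ℕ) :
    gaussTerm a b c n = fracCoeff a n * fracCoeff b n * (fracCoeff c n)⁻¹ := by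
  have h5 : (n.factorial : ℝ) ≠ 0 := by positivity
  rw [gaussTerm, fracCoeff, fracCoeff, fracCoeff, inv_div]
  field_simp

theorem gaussTerm_isBigO (a b : ℝ) {c : ℝ} (hc : 0 < c) :
    gaussTerm a b c =O[atTop] fun n : ℕ => (n : ℝ) ^ (a + b - c - 1) := by
  refine (((fracCoeff_isBigO a).mul (fracCoeff_isBigO b)).mul (fracCoeff_inv_isBigO hc)).congr'
    (.of_forall fun n => (gaussTerm_eq_fracCoeff a b c n).symm) ?_
  filter_upwards [eventually_ge_atTop 1] with n hn
  have : (0 : ℝ) < n := by exact_mod_cast hn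
  rw [← Real.rpow_add this, ← Real.rpow_add this]
  ring_nf

theorem summable_gaussTerm {a b c : ℝ} (hc : 0 < c) (habc : 0 < c - a - b) :
    Summable (gaussTerm a b c) :=
  summable_of_isBigO_nat (Real.summable_nat_rpow.2 (by linarith)) (gaussTerm_isBigO a b hc)

theorem tendsto_nat_mul_gaussTerm {a b c : ℝ} (hc : 0 < c) (habc : 0 < c - a - b) :
    Tendsto (fun n : ℕ => (n : ℝ) * gaussTerm a b c n) atTop (𝓝 0) := by
  have h : (fun n : ℕ => (n : ℝ) * gaussTerm a b c n) =O[atTop]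
      fun n : ℕ => (n : ℝ) ^ (-(c - a - b)) := by
    refine ((isBigO_refl (fun n : ℕ => (n : ℝ)) atTop).mul (gaussTerm_isBigO a b hc)).congr'
      EventuallyEq.rfl ?_
    filter_upwards [eventually_ge_atTop 1] with n hn
    have : (0 : ℝ) < n := by exact_mod_cast hn
    rw [← Real.rpow_one_add' (by positivity)]
    · ring_nf
    · intro h; linarith
  exact h.trans_tendsto ((tendsto_rpow_neg_atTop habc).comp tendsto_natCast_atTop_atTop)

theorem gaussTerm_succ (a b : ℝ) {c : ℝ} (hc : 0 < c) (n : ℕ) :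
    ((n + 1 : ℕ) : ℝ) * gaussTerm a b c (n + 1) =
      gaussTerm a b c n * ((a + n) * (b + n) / (c + n)) := by
  have h1 : (ascPochhammer ℝ n).eval c ≠ 0 := (ascPochhammer_pos n c hc).ne'
  have h2 : c + n ≠ 0 := by positivity
  have h5 : (n.factorial : ℝ) ≠ 0 := by positivity
  have h6 : ((n + 1 : ℕ) : ℝ) ≠ 0 := by positivity
  rw [gaussTerm, gaussTerm, ascPochhammer_succ_eval, ascPochhammer_succ_eval,
    ascPochhammer_succ_eval, Nat.factorial_succ, Nat.cast_mul]
  field_simp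

theorem gaussTerm_add_one (a b : ℝ) {c : ℝ} (hc : 0 < c) (n : ℕ) :
    gaussTerm a b (c + 1) n = gaussTerm a b c n * (c / (c + n)) := by
  have h1 : (ascPochhammer ℝ n).eval c ≠ 0 := (ascPochhammer_pos n c hc).ne'
  have h1' : (ascPochhammer ℝ n).eval (c + 1) ≠ 0 := (ascPochhammer_pos n _ (by linarith)).ne'
  have h2 : c + n ≠ 0 := by positivity
  have h3 : c ≠ 0 := hc.ne'
  have h5 : (n.factorial : ℝ) ≠ 0 := by positivity
  have h7 := ascPochhammer_succ_eval_left c n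
  rw [ascPochhammer_succ_eval] at h7
  rw [gaussTerm, gaussTerm]
  field_simp
  linear_combination (ascPochhammer ℝ n).eval a * (ascPochhammer ℝ n).eval b * h7

/-- Contiguous relation in `c`. The two summands differ by the telescoping `U (n+1) - U n` with `U n
= -c n t_n`, `t_n` the Gauss term; `U 0 = 0`, and `U n → 0` because `t_n = O(n^(a+b-c-1))`. -/
theorem tsum_gaussTerm_add_one {a b c : ℝ} (hc : 0 < c) (habc : 0 < c - a - b) :
    c * (c - a - b) * ∑' n, gaussTerm a b c n =
      (c - a) * (c - b) * ∑' n, gaussTerm a b (c + 1) n := by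
  set U : ℕ → ℝ := fun n => -c * ((n : ℝ) * gaussTerm a b c n) with hU
  have hU0 : Tendsto U atTop (𝓝 0) := by
    have h := (tendsto_nat_mul_gaussTerm hc habc).const_mul (-c)
    rwa [mul_zero] at h
  have h1 := (summable_gaussTerm hc habc).hasSum.mul_left (c * (c - a - b))
  have h2 := (summable_gaussTerm (a := a) (b := b) (c := c + 1) (by linarith)
    (by linarith)).hasSum.mul_left ((c - a) * (c - b))
  have h3 := (h1.sub h2).tendsto_sum_nat
  have h4 : ∀ n : ℕ, c * (c - a - b) * gaussTerm a b c n -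
      (c - a) * (c - b) * gaussTerm a b (c + 1) n = U (n + 1) - U n := fun n => by
    have h2 : c + n ≠ 0 := by positivity
    simp only [hU]
    rw [gaussTerm_succ a b hc, gaussTerm_add_one a b hc]
    field_simp
    ring
  simp only [h4, Finset.sum_range_sub] at h3
  have h5 : Tendsto (fun n => U n - U 0) atTop (𝓝 0) := by simpa [hU] using hU0
  linarith [tendsto_nhds_unique h3 h5]

theorem abs_gaussTerm_add_nat_le (a b : ℝ) {c : ℝ} (hc : 0 < c) (N n : ℕ) :
    |gaussTerm a b (c + N) n| ≤ |gaussTerm a b c n| := by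
  induction N with
  | zero => simp
  | succ N ih =>
    have hcN : 0 < c + N := by positivity
    refine le_trans ?_ ih
    rw [Nat.cast_succ, ← add_assoc, gaussTerm_add_one a b hcN, abs_mul]
    refine mul_le_of_le_one_right (abs_nonneg _) ?_
    rw [abs_of_nonneg (by positivity), div_le_one (by positivity)]
    have : (0 : ℝ) ≤ n := by positivity
    linarith

theorem tendsto_gaussTerm_add_nat (a b : ℝ) {c : ℝ} (hc : 0 < c) (n : ℕ) :
    Tendsto (fun N : ℕ => gaussTerm a b (c + N) (n + 1)) atTop (𝓝 0) := by
  set q : ℝ := (ascPochhammer ℝ (n + 1)).eval a * (ascPochhammer ℝ (n + 1)).eval b with hq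
  have h : Tendsto (fun N : ℕ => |q| * (c + N)⁻¹) atTop (𝓝 0) := by
    have : Tendsto (fun N : ℕ => c + (N : ℝ)) atTop atTop :=
      tendsto_atTop_add_const_left _ _ tendsto_natCast_atTop_atTop
    simpa using (tendsto_inv_atTop_zero.comp this).const_mul |q|
  refine squeeze_zero_norm' ?_ h
  filter_upwards [eventually_ge_atTop 1] with N hN
  have hcN : 0 < c + N := by positivity
  have h1 : (1 : ℝ) ≤ (ascPochhammer ℝ n).eval (c + N + 1) := by
    have : (1 : ℝ) ≤ N := by exact_mod_cast hN
    exact one_le_ascPochhammer_eval (by linarith) n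
  have h2 : (1 : ℝ) ≤ (n + 1).factorial := by
    exact_mod_cast Nat.one_le_iff_ne_zero.2 (by positivity)
  rw [Real.norm_eq_abs, gaussTerm, ← hq, ascPochhammer_succ_eval_left, abs_div, ← div_eq_mul_inv]
  refine div_le_div_of_nonneg_left (abs_nonneg _) hcN ?_
  rw [abs_of_nonneg (by positivity)]
  have := one_le_mul_of_one_le_of_one_le h1 h2
  nlinarith

/-- As the lower parameter grows, every term but the zeroth dies, while each stays dominated by its
value at `N = 0`. -/
theorem tendsto_tsum_gaussTerm_add_nat {a b c : ℝ} (hc : 0 < c) (habc : 0 < c - a - b) :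
    Tendsto (fun N : ℕ => ∑' n, gaussTerm a b (c + N) n) atTop (𝓝 1) := by
  have h := tendsto_tsum_of_dominated_convergence (𝓕 := atTop)
    (f := fun (N : ℕ) n => gaussTerm a b (c + N) n) (g := fun n : ℕ => if n = 0 then (1 : ℝ) else 0)
    (summable_gaussTerm hc habc).abs ?_
    (.of_forall fun N n => by simpa using abs_gaussTerm_add_nat_le a b hc N n)
  · simpa using h
  · intro n
    cases n with
    | zero => simp [gaussTerm]
    | succ n => simpa using tendsto_gaussTerm_add_nat a b hc n

/-- Gauss's summation formula, away from the poles of the Gamma function. -/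
theorem tsum_gaussTerm {a b c : ℝ} (hc : 0 < c) (habc : 0 < c - a - b) (ha : 0 < c - a)
    (hb : 0 < c - b) :
    ∑' n, gaussTerm a b c n =
      Real.Gamma c * Real.Gamma (c - a - b) / (Real.Gamma (c - a) * Real.Gamma (c - b)) := by
  -- The contiguous relation iterated `N` times, the accumulated factors being collected into two
  -- Gamma quotients. These behave like `N^(-a)` and `N^a`, so the correction to the closed form
  -- tends to `1`.
  have key : ∀ N : ℕ, (∑' n, gaussTerm a b c n) =
      Real.Gamma c * Real.Gamma (c - a - b) / (Real.Gamma (c - a) * Real.Gamma (c - b)) *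
      ((∑' n, gaussTerm a b (c + N) n) *
        (gammaRatio (c - a) c N * gammaRatio (c - b) (c - a - b) N)) := by
    intro N
    have g : ∀ {x : ℝ}, 0 < x → Real.Gamma x ≠ 0 := fun hx => (Real.Gamma_pos_of_pos hx).ne'
    have g1 := g hc
    have g2 := g habc
    have g3 := g ha
    have g4 := g hb
    induction N with
    | zero =>
      simp only [gammaRatio, Nat.cast_zero, add_zero, zero_add]
      field_simp
    | succ N ih =>
      have hN : (0 : ℝ) ≤ N := by positivity
      have p1 : 0 < N + c := by linarith
      have p2 : 0 < N + (c - a - b) := by linarith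
      have p3 : 0 < N + (c - a) := by linarith
      have p4 : 0 < N + (c - b) := by linarith
      have e := tsum_gaussTerm_add_one (a := a) (b := b) (c := c + N) (by linarith) (by linarith)
      rw [ih, Nat.cast_succ, ← add_assoc c]
      have q1 := g p1
      have q2 := g p2
      have q3 := g p3
      have q4 := g p4
      simp only [gammaRatio, add_right_comm (N : ℝ) 1, Real.Gamma_add_one p1.ne',
        Real.Gamma_add_one p2.ne', Real.Gamma_add_one p3.ne', Real.Gamma_add_one p4.ne']
      congr 1
      have p1' := p1.ne'
      have p2' := p2.ne'
      field_simp
      linear_combination e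
  have hlim : Tendsto (fun N : ℕ => gammaRatio (c - a) c N * gammaRatio (c - b) (c - a - b) N)
      atTop (𝓝 1) := by
    have h := (tendsto_gammaRatio (c - a) c).mul (tendsto_gammaRatio (c - b) (c - a - b))
    rw [one_mul] at h
    refine h.congr' ?_
    filter_upwards [eventually_ge_atTop 1] with n hn
    have hn : (0 : ℝ) < n := by exact_mod_cast hn
    rw [show c - b - (c - a - b) = a by ring, show c - a - c = -a by ring, div_mul_div_comm,
      ← Real.rpow_add hn]
    simp
  have h := ((tendsto_tsum_gaussTerm_add_nat hc habc).mul hlim).const_mul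
    (Real.Gamma c * Real.Gamma (c - a - b) / (Real.Gamma (c - a) * Real.Gamma (c - b)))
  rw [one_mul, mul_one] at h
  exact tendsto_nhds_unique (tendsto_const_nhds.congr key) h

/-! ### The autocovariance function of fractional noise -/

/-- After extracting `(d)_h / h!` the terms are those of `₂F₁(d, d+h; h+1; 1)`. Gauss's condition `c
- a - b > 0` reads `1 - 2d > 0`. -/
theorem hasSum_fracCoeff_mul {d : ℝ} (hd : d < 1 / 2) (h : ℕ) :
    HasSum (fun j => fracCoeff d j * fracCoeff d (j + h))
      (Real.Gamma (1 - 2 * d) * (ascPochhammer ℝ h).eval d /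
        (Real.Gamma (1 - d + h) * Real.Gamma (1 - d))) := by
  have hh : (0 : ℝ) ≤ h := by positivity
  have e := (summable_gaussTerm (a := d) (b := d + h) (c := h + 1) (by linarith)
    (by linarith)).hasSum
  rw [tsum_gaussTerm (by linarith) (by linarith) (by linarith) (by linarith),
    show (h : ℝ) + 1 - d - (d + h) = 1 - 2 * d by ring, show (h : ℝ) + 1 - (d + h) = 1 - d by ring,
    show (h : ℝ) + 1 - d = 1 - d + h by ring, Real.Gamma_nat_eq_factorial] at e
  have h0 : (h.factorial : ℝ) ≠ 0 := by positivity
  have e' : Real.Gamma (1 - 2 * d) * (ascPochhammer ℝ h).eval d /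
      (Real.Gamma (1 - d + h) * Real.Gamma (1 - d)) =
      (ascPochhammer ℝ h).eval d / h.factorial * (h.factorial * Real.Gamma (1 - 2 * d) /
        (Real.Gamma (1 - d + h) * Real.Gamma (1 - d))) := by
    field_simp
  rw [e']
  refine (e.mul_left ((ascPochhammer ℝ h).eval d / h.factorial)).congr_fun fun j => ?_
  have h1 : (j.factorial : ℝ) ≠ 0 := by positivity
  have h2 : (ascPochhammer ℝ j).eval ((h : ℝ) + 1) ≠ 0 :=
    (ascPochhammer_pos j _ (by positivity)).ne'
  have h3 : ((j + h).factorial : ℝ) = h.factorial * (ascPochhammer ℝ j).eval ((h : ℝ) + 1) := by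
    rw [add_comm j h, factorial_mul_ascPochhammer]
  rw [fracCoeff, fracCoeff, gaussTerm, h3, add_comm j h, ascPochhammer_add_eval]
  field_simp

/-- Working with `1/Γ` makes the recursion `1/Γ(y) = y/Γ(y+1)` valid at the poles too, given
Mathlib's value `0` there; hence integer `d` needs no separate case. -/
theorem inv_Gamma_sub_nat (d : ℝ) (h : ℕ) :
    (Real.Gamma (1 - d - h))⁻¹ =
      (-1) ^ h * (ascPochhammer ℝ h).eval d * (Real.Gamma (1 - d))⁻¹ := by
  induction h with
  | zero => simp
  | succ h ih =>
    have key : ∀ y : ℝ, (Real.Gamma y)⁻¹ = y * (Real.Gamma (y + 1))⁻¹ := fun y => by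
      by_cases hy : y = 0
      · simp [hy]
      · rw [Real.Gamma_add_one hy, mul_inv, ← mul_assoc, mul_inv_cancel₀ hy, one_mul]
    rw [key, Nat.cast_succ, show 1 - d - ((h : ℝ) + 1) + 1 = 1 - d - h by ring, ih,
      ascPochhammer_succ_eval]
    ring

theorem gammaV_mul_natCast {s : ℕ} (hs : 0 < s) (d v : ℝ) (h : ℕ) :
    gammaV s d v ((s : ℤ) * h) =
      v * (Real.Gamma (1 - 2 * d) * (ascPochhammer ℝ h).eval d /
        (Real.Gamma (1 - d + h) * Real.Gamma (1 - d))) := by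
  have hs' : (s : ℤ) ≠ 0 := by omega
  rw [gammaV, if_pos (dvd_mul_right _ _), Int.mul_ediv_cancel_left _ hs', Int.cast_natCast,
    zpow_natCast, div_eq_mul_inv _ (_ * _), mul_inv, inv_Gamma_sub_nat, div_eq_mul_inv, mul_inv]
  have : (-1 : ℝ) ^ h * (-1) ^ h = 1 := by rw [← mul_pow]; simp
  linear_combination (v * Real.Gamma (1 - 2 * d) * (ascPochhammer ℝ h).eval d *
    (Real.Gamma (1 - d + h))⁻¹ * (Real.Gamma (1 - d))⁻¹) * this

theorem gammaV_neg (s : ℕ) (d v : ℝ) (m : ℤ) : gammaV s d v (-m) = gammaV s d v m := by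
  by_cases h : (s : ℤ) ∣ m
  · rw [gammaV, gammaV, if_pos h, if_pos (h.neg_right), Int.neg_ediv_of_dvd h, zpow_neg,
      ← inv_zpow, inv_neg, inv_one]
    push_cast
    rw [sub_neg_eq_add, ← sub_eq_add_neg, mul_comm (Real.Gamma (1 - d - _))]
  · rw [gammaV, gammaV, if_neg h, if_neg (fun h' => h (by simpa using h'.neg_right))]

theorem gammaV_eq_mul (s : ℕ) (d v : ℝ) (m : ℤ) : gammaV s d v m = v * gammaV s d 1 m := by
  simp [gammaV]

/-! ### Two-sided sequences -/

/-- Extension of a sequence to `ℤ` by zero. -/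
def extendZ (a : ℕ → ℝ) (n : ℤ) : ℝ := if 0 ≤ n then a n.toNat else 0

@[simp] theorem extendZ_natCast (a : ℕ → ℝ) (n : ℕ) : extendZ a n = a n := by simp [extendZ]

theorem extendZ_of_neg (a : ℕ → ℝ) {n : ℤ} (hn : n < 0) : extendZ a n = 0 := by
  rw [extendZ, if_neg (by omega)]

theorem hasSum_int_iff_of_neg {g : ℤ → ℝ} (hg : ∀ n < 0, g n = 0) (x : ℝ) :
    HasSum g x ↔ HasSum (fun n : ℕ => g n) x := by
  refine (Function.Injective.hasSum_iff (g := fun n : ℕ => (n : ℤ)) Nat.cast_injective ?_).symm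
  intro n hn
  refine hg n ?_
  by_contra h
  exact hn ⟨n.toNat, by simp; omega⟩

theorem hasSum_extendZ_iff {a : ℕ → ℝ} {x : ℝ} : HasSum (extendZ a) x ↔ HasSum a x := by
  rw [hasSum_int_iff_of_neg fun n hn => extendZ_of_neg a hn]
  simp

theorem hasSum_extendZ_mul {a : ℕ → ℝ} {x : ℝ} (m : ℤ)
    (h : HasSum (fun i => a i * a (i + m.natAbs)) x) :
    HasSum (fun i => extendZ a i * extendZ a (i + m)) x := by
  have key : HasSum (fun i : ℤ => extendZ a i * extendZ a (i + m.natAbs)) x := by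
    rw [hasSum_int_iff_of_neg fun n hn => by rw [extendZ_of_neg a hn, zero_mul]]
    refine h.congr_fun fun n => ?_
    rw [← Nat.cast_add, extendZ_natCast, extendZ_natCast]
  rcases Int.natAbs_eq m with hm | hm
  · rwa [← hm] at key
  -- For `m = -|m|`, shifting the index by `m` interchanges the two factors.
  · rw [← (Equiv.addRight m).hasSum_iff] at key
    refine key.congr_fun fun i => ?_
    simp only [Function.comp_apply, Equiv.coe_addRight]
    rw [mul_comm]
    congr 2
    omega

/-- The sequence lives on multiples of `s`: for `s ∤ m` the two factors are never both nonzero, and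
for `s ∣ m` the sum reduces to the non-seasonal one. -/
theorem hasSum_seasCoeff_mul {s : ℕ} (hs : 0 < s) {d : ℝ} (hd : d < 1 / 2) (m : ℤ) :
    HasSum (fun i => extendZ (seasCoeff s d) i * extendZ (seasCoeff s d) (i + m))
      (gammaV s d 1 m) := by
  refine hasSum_extendZ_mul m ?_
  by_cases hm : (s : ℤ) ∣ m
  · obtain ⟨h, hh⟩ := Int.natCast_dvd.1 hm
    have e : gammaV s d 1 m = gammaV s d 1 ((s : ℤ) * h) := by
      rcases Int.natAbs_eq m with hm | hm
      · rw [hm, hh]; push_cast; rfl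
      · rw [hm, hh, gammaV_neg]; push_cast; rfl
    rw [e, gammaV_mul_natCast hs, one_mul, hh]
    have inj : Function.Injective fun j : ℕ => s * j := fun a b hab =>
      Nat.eq_of_mul_eq_mul_left hs hab
    refine (inj.hasSum_iff ?_).1 ?_
    · intro i hi
      have : ¬ s ∣ i := fun ⟨j, hj⟩ => hi ⟨j, hj.symm⟩
      simp [seasCoeff, this]
    · refine (hasSum_fracCoeff_mul hd h).congr_fun fun j => ?_
      simp [seasCoeff, ← mul_add, Nat.mul_div_cancel_left _ hs]
  · have e : gammaV s d 1 m = 0 := by simp [gammaV, hm]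
    rw [e]
    refine hasSum_zero.congr_fun fun i => ?_
    by_cases hi : s ∣ i
    · have : ¬ s ∣ i + m.natAbs := fun h => hm (Int.natCast_dvd.2 ((Nat.dvd_add_right hi).1 h))
      simp [seasCoeff, this]
    · simp [seasCoeff, hi]

theorem hasSum_extendZ_coeff_mul (f g : PowerSeries ℝ) (k : ℤ) :
    HasSum (fun a : ℤ => extendZ (fun n => PowerSeries.coeff n f) a *
        extendZ (fun n => PowerSeries.coeff n g) (k - a))
      (extendZ (fun n => PowerSeries.coeff n (f * g)) k) := by
  rw [hasSum_int_iff_of_neg fun n hn => by rw [extendZ_of_neg _ hn, zero_mul]]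
  rcases lt_or_ge k 0 with hk | hk
  · rw [extendZ_of_neg _ hk]
    refine hasSum_zero.congr_fun fun a => ?_
    rw [extendZ_of_neg _ (by omega : k - a < 0), mul_zero]
  · lift k to ℕ using hk
    rw [extendZ_natCast, PowerSeries.coeff_mul, Finset.Nat.sum_antidiagonal_eq_sum_range_succ
      (fun i j => PowerSeries.coeff i f * PowerSeries.coeff j g)]
    have : ∀ i ∈ Finset.range k.succ, PowerSeries.coeff i f * PowerSeries.coeff (k - i) g =
        extendZ (fun n => PowerSeries.coeff n f) (i : ℤ) *
          extendZ (fun n => PowerSeries.coeff n g) (k - i) := fun i hi => by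
      rw [← Nat.cast_sub (by simpa [Nat.lt_succ_iff] using hi)]
      simp
    rw [Finset.sum_congr rfl this]
    refine hasSum_sum_of_ne_finset_zero fun i hi => ?_
    rw [extendZ_of_neg _ (_ : (k : ℤ) - i < 0), mul_zero]
    simp at hi
    omega

/-- The autocovariance function of a linear filter applied to a sequence. -/
theorem exists_hasSum_autocov_convolution {F p L G R : ℤ → ℝ} (hF : Summable F)
    (hp : Summable fun i => p i ^ 2) (hL : ∀ k, HasSum (fun a => F a * p (k - a)) (L k))
    (hG : ∀ j, HasSum (fun i => F i * F (i + j)) (G j))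
    (hR : ∀ m, HasSum (fun i => p i * p (i + m)) (R m)) (m : ℤ) :
    ∃ T, HasSum (fun k => L k * L (k + m)) T ∧ HasSum (fun j => G j * R (m - j)) T := by
  -- A triple family in `((a, b), k)`, summed in two orders. It is absolutely summable: by `xy ≤ (x²
  -- + y²)/2` the sum over `k` is at most `|F a| |F b| ∑ p²`. With `k` outermost it gives the
  -- products `L k * L (k + m)`; with `k` innermost it gives `F a * F b * R (m + a - b)`.
  set Φ : (ℤ × ℤ) × ℤ → ℝ := fun x =>
    (F x.1.1 * p (x.2 - x.1.1)) * (F x.1.2 * p (x.2 + m - x.1.2)) with hΦ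
  have hps : ∀ c : ℤ, HasSum (fun k => p (k + c) ^ 2) (∑' i, p i ^ 2) := fun c =>
    ((Equiv.addRight c).hasSum_iff (f := fun i => p i ^ 2)).2 hp.hasSum
  have hb : ∀ a b : ℤ, (Summable fun k : ℤ => ‖Φ ((a, b), k)‖) ∧
      ∑' k : ℤ, ‖Φ ((a, b), k)‖ ≤ |F a| * |F b| * ∑' i, p i ^ 2 := by
    intro a b
    have h1 := (((hps (-a)).add (hps (m - b))).mul_left (1 / 2)).mul_left (|F a| * |F b|)
    rw [← two_mul, ← mul_assoc (1 / 2), one_div_mul_cancel two_ne_zero, one_mul] at h1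
    have hle : ∀ k : ℤ, ‖Φ ((a, b), k)‖ ≤
        |F a| * |F b| * (1 / 2 * (p (k + -a) ^ 2 + p (k + (m - b)) ^ 2)) := fun k => by
      have h3 : |p (k - a)| * |p (k + m - b)| ≤
          1 / 2 * (p (k + -a) ^ 2 + p (k + (m - b)) ^ 2) := by
        rw [← sub_eq_add_neg, ← add_sub_assoc, ← sq_abs (p (k - a)), ← sq_abs (p (k + m - b))]
        nlinarith [sq_nonneg (|p (k - a)| - |p (k + m - b)|)]
      calc ‖Φ ((a, b), k)‖ = |F a| * |F b| * (|p (k - a)| * |p (k + m - b)|) := by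
            simp only [hΦ, Real.norm_eq_abs, abs_mul]
            ring
        _ ≤ _ := by gcongr
    have h2 : Summable fun k : ℤ => ‖Φ ((a, b), k)‖ :=
      .of_nonneg_of_le (fun _ => norm_nonneg _) hle h1.summable
    exact ⟨h2, (h2.tsum_le_tsum hle h1.summable).trans h1.tsum_eq.le⟩
  have hΦs : Summable Φ := by
    refine Summable.of_norm ?_
    refine (summable_prod_of_nonneg fun x => norm_nonneg _).2 ⟨fun x => (hb x.1 x.2).1, ?_⟩
    refine .of_nonneg_of_le (fun x => tsum_nonneg fun _ => norm_nonneg _)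
      (fun x => (hb x.1 x.2).2) ?_
    exact (hF.abs.mul_of_nonneg hF.abs (fun _ => abs_nonneg _) fun _ => abs_nonneg _).mul_right _
  obtain ⟨T, hT⟩ := hΦs
  refine ⟨T, ?_, ?_⟩
  · have h1 := (Equiv.prodComm ℤ (ℤ × ℤ)).hasSum_iff.2 hT
    refine h1.prod_fiberwise fun k => ?_
    exact (hL k).mul (hL (k + m)) (h1.summable.prod_factor k)
  · have h1 := hT.prod_fiberwise (g := fun x => F x.1 * F x.2 * R (m + x.1 - x.2)) fun x => by
      have h := ((Equiv.subRight x.1).hasSum_iff.2 (hR (m + x.1 - x.2))).mul_left (F x.1 * F x.2)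
      refine h.congr_fun fun k => ?_
      simp only [hΦ, Function.comp_apply, Equiv.subRight_apply]
      rw [show k - x.1 + (m + x.1 - x.2) = k + m - x.2 by ring]
      ring
    -- Reindexing by the lag `j = b - a`: the pair `(j, a)` goes to `(a, a + j)`.
    let e : ℤ × ℤ ≃ ℤ × ℤ :=
      { toFun := fun x => (x.2, x.2 + x.1)
        invFun := fun x => (x.2 - x.1, x.1)
        left_inv := fun x => by simp
        right_inv := fun x => by simp }
    refine (e.hasSum_iff.2 h1).prod_fiberwise fun j => ?_
    refine ((hG j).mul_right (R (m - j))).congr_fun fun a => ?_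
    simp only [Function.comp_apply, e, Equiv.coe_fn_mk]
    rw [show m + a - (a + j) = m - j by ring]

/-! ### Geometric decay of the coefficients of `α / β` -/

/-- The coefficients decay geometrically: the power series converges absolutely on a disc of radius
larger than `1`. -/
def IsOverconvergent (f : PowerSeries ℂ) : Prop :=
  ∃ R : ℝ, 1 < R ∧ Summable fun k => ‖PowerSeries.coeff k f‖ * R ^ k

/-- Cauchy product of absolutely convergent series at the smaller of the two radii. -/
theorem IsOverconvergent.mul {f g : PowerSeries ℂ} (hf : IsOverconvergent f)
    (hg : IsOverconvergent g) : IsOverconvergent (f * g) := by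
  obtain ⟨R, hR, hf⟩ := hf
  obtain ⟨S, hS, hg⟩ := hg
  have key : ∀ {f : PowerSeries ℂ} {R T : ℝ}, 1 < T → T ≤ R →
      (Summable fun k => ‖PowerSeries.coeff k f‖ * R ^ k) →
      Summable fun k => ‖PowerSeries.coeff k f * (T : ℂ) ^ k‖ := fun {f R T} hT hTR h => by
    refine .of_nonneg_of_le (fun _ => norm_nonneg _) (fun k => ?_) h
    rw [norm_mul, norm_pow, Complex.norm_real, Real.norm_of_nonneg (by linarith)]
    have : 0 ≤ T := by linarith
    gcongr
  have hT : 1 < min R S := lt_min hR hS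
  refine ⟨min R S, hT, ?_⟩
  have h := summable_norm_sum_mul_antidiagonal_of_summable_norm (key hT (min_le_left _ _) hf)
    (key hT (min_le_right _ _) hg)
  refine h.congr fun n => ?_
  have e : ∑ kl ∈ Finset.HasAntidiagonal.antidiagonal n,
      PowerSeries.coeff kl.1 f * ((min R S : ℝ) : ℂ) ^ kl.1 *
      (PowerSeries.coeff kl.2 g * ((min R S : ℝ) : ℂ) ^ kl.2) =
      PowerSeries.coeff n (f * g) * ((min R S : ℝ) : ℂ) ^ n := by
    rw [PowerSeries.coeff_mul, Finset.sum_mul]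
    refine Finset.sum_congr rfl fun kl hkl => ?_
    rw [← Finset.HasAntidiagonal.mem_antidiagonal.1 hkl, pow_add]
    ring
  rw [e, norm_mul, norm_pow, Complex.norm_real, Real.norm_of_nonneg (by linarith)]

theorem isOverconvergent_coe (p : Polynomial ℂ) : IsOverconvergent (p : PowerSeries ℂ) := by
  refine ⟨2, by norm_num, summable_of_ne_finset_zero (s := p.support) fun k hk => ?_⟩
  rw [Polynomial.coeff_coe, Polynomial.notMem_support_iff.1 hk, norm_zero, zero_mul]

/-- The inverse is the geometric series `-∑ r^(-(k+1)) X^k`, absolutely convergent at any radius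
strictly between `1` and `‖r‖`. -/
theorem isOverconvergent_inv_X_sub_C {r : ℂ} (hr : 1 < ‖r‖) :
    IsOverconvergent ((Polynomial.X - Polynomial.C r : Polynomial ℂ) : PowerSeries ℂ)⁻¹ := by
  have hr0 : r ≠ 0 := norm_pos_iff.1 (by linarith)
  have e : ((Polynomial.X - Polynomial.C r : Polynomial ℂ) : PowerSeries ℂ)⁻¹ =
      PowerSeries.mk fun k => -(r⁻¹) ^ (k + 1) := by
    symm
    rw [PowerSeries.eq_inv_iff_mul_eq_one (by simp [hr0])]
    ext n
    rw [Polynomial.coe_sub, Polynomial.coe_X, Polynomial.coe_C, mul_sub, map_sub,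
      PowerSeries.coeff_mul_C, PowerSeries.coeff_one]
    cases n with
    | zero => simp [hr0]
    | succ n =>
      rw [PowerSeries.coeff_succ_mul_X, PowerSeries.coeff_mk, PowerSeries.coeff_mk,
        pow_succ _ (n + 1)]
      have : r⁻¹ * r = 1 := inv_mul_cancel₀ hr0
      simp only [Nat.add_eq_zero_iff, one_ne_zero, and_false, if_false]
      linear_combination (r⁻¹) ^ (n + 1) * this
  obtain ⟨R, hR1, hR2⟩ := exists_between hr
  refine ⟨R, hR1, ?_⟩
  rw [e]
  have hs : Summable fun k : ℕ => ‖r‖⁻¹ * (R / ‖r‖) ^ k :=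
    (summable_geometric_of_lt_one (by positivity) ((div_lt_one (by linarith)).2 hR2)).mul_left _
  refine hs.congr fun k => ?_
  rw [PowerSeries.coeff_mk, norm_neg, norm_pow, norm_inv, div_pow, pow_succ, inv_pow]
  field_simp

/-- Roots are split off one at a time; each lies outside the closed unit disc, so the inverse is a
product of overconvergent geometric series and a constant. -/
theorem isOverconvergent_inv (n : ℕ) (p : Polynomial ℂ) (hn : p.natDegree = n)
    (hp : ∀ z : ℂ, ‖z‖ ≤ 1 → p.eval z ≠ 0) : IsOverconvergent (p : PowerSeries ℂ)⁻¹ := by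
  induction n generalizing p with
  | zero =>
    rw [Polynomial.eq_C_of_natDegree_eq_zero hn]
    have h : ((Polynomial.C (p.coeff 0) : Polynomial ℂ) : PowerSeries ℂ)⁻¹ =
        ((Polynomial.C (p.coeff 0)⁻¹ : Polynomial ℂ) : PowerSeries ℂ) := by
      rw [Polynomial.coe_C, Polynomial.coe_C]
      simp
    rw [h]
    exact isOverconvergent_coe _
  | succ n ih =>
    have hdeg : p.degree ≠ 0 := fun h => by
      have := Polynomial.natDegree_eq_zero_iff_degree_le_zero.2 h.le
      omega
    obtain ⟨r, hr⟩ := IsAlgClosed.exists_root p hdeg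
    obtain ⟨q, rfl⟩ := Polynomial.dvd_iff_isRoot.2 hr
    have hr1 : 1 < ‖r‖ := by
      by_contra h
      exact hp r (by linarith) hr
    have hq0 : q ≠ 0 := fun h => by simp [h] at hn
    have hq : IsOverconvergent (q : PowerSeries ℂ)⁻¹ := by
      refine ih q ?_ fun z hz h => hp z hz (by simp [h])
      rw [Polynomial.natDegree_mul (Polynomial.X_sub_C_ne_zero r) hq0,
        Polynomial.natDegree_X_sub_C] at hn
      omega
    rw [Polynomial.coe_mul, PowerSeries.mul_inv_rev]
    exact hq.mul (isOverconvergent_inv_X_sub_C hr1)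

theorem armaCoeff_mul (α β : Polynomial ℝ) (hβ : β.coeff 0 = 1) :
    ((α : PowerSeries ℝ) * (β : PowerSeries ℝ)⁻¹) * β = α := by
  rw [mul_assoc, PowerSeries.inv_mul_cancel _ (by simp [Polynomial.constantCoeff_coe, hβ]), mul_one]

theorem isOverconvergent_arma (α β : Polynomial ℝ) (hβ0 : β.coeff 0 = 1)
    (hβ : ∀ z : ℂ, ‖z‖ ≤ 1 → Polynomial.aeval z β ≠ 0) :
    ∃ R : ℝ, 1 < R ∧ Summable fun k => |armaCoeff α β k| * R ^ k := by
  have h1 := (isOverconvergent_coe (α.map (algebraMap ℝ ℂ))).mul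
    (isOverconvergent_inv _ (β.map (algebraMap ℝ ℂ)) rfl fun z hz => by
      rw [Polynomial.eval_map_algebraMap]; exact hβ z hz)
  have h2 : ((α.map (algebraMap ℝ ℂ) : Polynomial ℂ) : PowerSeries ℂ) *
      ((β.map (algebraMap ℝ ℂ) : Polynomial ℂ) : PowerSeries ℂ)⁻¹ =
      PowerSeries.map (algebraMap ℝ ℂ) ((α : PowerSeries ℝ) * (β : PowerSeries ℝ)⁻¹) := by
    symm
    rw [PowerSeries.eq_mul_inv_iff_mul_eq
      (by rw [Polynomial.constantCoeff_coe]; simp [hβ0]),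
      Polynomial.polynomial_map_coe, Polynomial.polynomial_map_coe, ← map_mul,
      armaCoeff_mul α β hβ0]
  rw [h2] at h1
  obtain ⟨R, hR, h⟩ := h1
  refine ⟨R, hR, h.congr fun k => ?_⟩
  rw [PowerSeries.coeff_map]
  simp [armaCoeff]

/-- A two-sided sequence bounded by a geometric sequence on both sides. -/
def GeomDecay (A : ℤ → ℝ) : Prop :=
  ∃ C ρ : ℝ, 0 < ρ ∧ ρ < 1 ∧ ∀ k, |A k| ≤ C * ρ ^ k.natAbs

theorem summable_pow_natAbs {ρ : ℝ} (h0 : 0 < ρ) (h1 : ρ < 1) :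
    Summable fun k : ℤ => ρ ^ k.natAbs := by
  have h := summable_geometric_of_lt_one h0.le h1
  refine Summable.of_nat_of_neg ?_ ?_ <;> simpa using h

theorem GeomDecay.summable {A : ℤ → ℝ} (hA : GeomDecay A) : Summable A := by
  obtain ⟨C, ρ, h0, h1, h⟩ := hA
  exact Summable.of_norm_bounded ((summable_pow_natAbs h0 h1).mul_left C) h

theorem GeomDecay.comp_mul_add {A : ℤ → ℝ} (hA : GeomDecay A) {s : ℕ} (hs : 0 < s) (r : ℕ) :
    GeomDecay fun k => A ((s : ℤ) * k + (r : ℤ)) := by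
  obtain ⟨C, ρ, h0, h1, h⟩ := hA
  have hC : 0 ≤ C := by
    have := (abs_nonneg _).trans (h 0)
    simpa using this
  refine ⟨C * (ρ ^ r)⁻¹, ρ, h0, h1, fun k => (h _).trans ?_⟩
  rw [mul_assoc]
  refine mul_le_mul_of_nonneg_left ?_ hC
  rw [inv_mul_eq_div, le_div_iff₀ (by positivity), ← pow_add]
  refine pow_le_pow_of_le_one h0.le h1.le ?_
  have e1 : ((s : ℤ) * k).natAbs = s * k.natAbs := by rw [Int.natAbs_mul, Int.natAbs_natCast]
  have e2 : k.natAbs ≤ s * k.natAbs := Nat.le_mul_of_pos_left _ hs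
  omega

theorem geomDecay_extendZ_arma (α β : Polynomial ℝ) (hβ0 : β.coeff 0 = 1)
    (hβ : ∀ z : ℂ, ‖z‖ ≤ 1 → Polynomial.aeval z β ≠ 0) :
    GeomDecay (extendZ (armaCoeff α β)) := by
  obtain ⟨R, hR, h⟩ := isOverconvergent_arma α β hβ0 hβ
  have hR0 : 0 < R := by linarith
  refine ⟨∑' k, |armaCoeff α β k| * R ^ k, R⁻¹, by positivity, inv_lt_one_of_one_lt₀ hR,
    fun k => ?_⟩
  rcases lt_or_ge k 0 with hk | hk
  · rw [extendZ_of_neg _ hk, abs_zero]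
    exact mul_nonneg (tsum_nonneg fun _ => by positivity) (by positivity)
  · lift k to ℕ using hk
    have := h.le_tsum k fun _ _ => by positivity
    rw [extendZ_natCast, Int.natAbs_natCast, inv_pow, ← div_eq_mul_inv, le_div_iff₀ (by positivity)]
    exact this

theorem summable_armaCoeff (α β : Polynomial ℝ) (hβ0 : β.coeff 0 = 1)
    (hβ : ∀ z : ℂ, ‖z‖ ≤ 1 → Polynomial.aeval z β ≠ 0) : Summable (armaCoeff α β) :=
  (hasSum_extendZ_iff.1 (geomDecay_extendZ_arma α β hβ0 hβ).summable.hasSum).summable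

theorem hasSum_polynomial_coeff (p : Polynomial ℝ) :
    HasSum (fun k => PowerSeries.coeff k (p : PowerSeries ℝ)) (p.eval 1) := by
  have : p.eval 1 = ∑ k ∈ p.support, PowerSeries.coeff k (p : PowerSeries ℝ) := by
    simp [Polynomial.eval_eq_sum, Polynomial.sum]
  rw [this]
  exact hasSum_sum_of_ne_finset_zero fun k hk => by
    rw [Polynomial.coeff_coe, Polynomial.notMem_support_iff.1 hk]

/-- The identity `f β = α` evaluated at `1` through the Cauchy product; `β(1) ≠ 0` because `1` lies
in the closed disc. -/
theorem hasSum_armaCoeff (α β : Polynomial ℝ) (hβ0 : β.coeff 0 = 1)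
    (hβ : ∀ z : ℂ, ‖z‖ ≤ 1 → Polynomial.aeval z β ≠ 0) :
    HasSum (armaCoeff α β) (α.eval 1 / β.eval 1) := by
  have h1 := summable_armaCoeff α β hβ0 hβ
  have h2 := hasSum_polynomial_coeff β
  have h := tsum_mul_tsum_eq_tsum_sum_antidiagonal_of_summable_norm h1.norm h2.summable.norm
  have hb : β.eval 1 ≠ 0 := fun h0 => by
    refine hβ 1 (by simp) ?_
    have := Polynomial.aeval_algebraMap_apply ℂ (1 : ℝ) β
    rw [map_one] at this
    rw [this]
    simp [h0]
  have e : ∀ n, ∑ kl ∈ Finset.HasAntidiagonal.antidiagonal n,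
      armaCoeff α β kl.1 * PowerSeries.coeff kl.2 (β : PowerSeries ℝ) =
      PowerSeries.coeff n (α : PowerSeries ℝ) := fun n => by
    conv_rhs => rw [← armaCoeff_mul α β hβ0, PowerSeries.coeff_mul]
    rfl
  simp only [e] at h
  rw [h2.tsum_eq, (hasSum_polynomial_coeff α).tsum_eq] at h
  rw [← h, mul_div_cancel_right₀ _ hb]
  exact h1.hasSum

theorem hasSum_gammaA (α β : Polynomial ℝ) (hβ0 : β.coeff 0 = 1)
    (hβ : ∀ z : ℂ, ‖z‖ ≤ 1 → Polynomial.aeval z β ≠ 0) (m : ℤ) :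
    HasSum (fun i => armaCoeff α β i * armaCoeff α β (i + m.natAbs)) (gammaA α β m) := by
  refine Summable.hasSum (Summable.of_norm ?_)
  obtain ⟨C, ρ, h0, h1, h⟩ := geomDecay_extendZ_arma α β hβ0 hβ
  have hC : 0 ≤ C := by simpa using (abs_nonneg _).trans (h 0)
  refine .of_nonneg_of_le (fun _ => norm_nonneg _) (fun i => ?_)
    ((summable_armaCoeff α β hβ0 hβ).abs.mul_right C)
  rw [norm_mul]
  refine mul_le_mul_of_nonneg_left ?_ (norm_nonneg _)
  have := h ((i + m.natAbs : ℕ) : ℤ)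
  rw [extendZ_natCast, Int.natAbs_natCast] at this
  exact this.trans (mul_le_of_le_one_right hC (pow_le_one₀ h0.le h1.le))

/-- In `f_i f_{i+|m|}` the second factor is at most `C ρ^|m|` and the first is absolutely summable.
-/
theorem geomDecay_gammaA (α β : Polynomial ℝ) (hβ0 : β.coeff 0 = 1)
    (hβ : ∀ z : ℂ, ‖z‖ ≤ 1 → Polynomial.aeval z β ≠ 0) : GeomDecay (gammaA α β) := by
  obtain ⟨C, ρ, h0, h1, h⟩ := geomDecay_extendZ_arma α β hβ0 hβ
  have hC : 0 ≤ C := by simpa using (abs_nonneg _).trans (h 0)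
  refine ⟨(∑' i, |armaCoeff α β i|) * C, ρ, h0, h1, fun m => ?_⟩
  have hs := (summable_armaCoeff α β hβ0 hβ).abs.hasSum.mul_right (C * ρ ^ m.natAbs)
  rw [← mul_assoc] at hs
  rw [gammaA, ← Real.norm_eq_abs]
  refine tsum_of_norm_bounded hs fun i => ?_
  rw [norm_mul]
  refine mul_le_mul_of_nonneg_left ?_ (norm_nonneg _)
  have := h ((i + m.natAbs : ℕ) : ℤ)
  rw [extendZ_natCast, Int.natAbs_natCast] at this
  refine this.trans (mul_le_mul_of_nonneg_left ?_ hC)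
  exact pow_le_pow_of_le_one h0.le h1.le (by omega)

/-! ### Truncation of convolutions at `⌊√h⌋` -/

theorem tendsto_sqrt_atTop : Tendsto Nat.sqrt atTop atTop :=
  tendsto_atTop_atTop.2 fun b => ⟨b * b, fun _ ha => Nat.le_sqrt.2 ha⟩

theorem pow_sqrt_isLittleO {ρ : ℝ} (h0 : 0 < ρ) (h1 : ρ < 1) (ν : ℝ) :
    (fun h : ℕ => ρ ^ Nat.sqrt h) =o[atTop] fun h : ℕ => (h : ℝ) ^ (-ν) := by
  obtain ⟨M, hM⟩ := exists_nat_ge ν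
  have hlim : Tendsto (fun h : ℕ => ρ⁻¹ * (((Nat.sqrt h + 1 : ℕ) : ℝ) ^ (2 * M) *
      ρ ^ (Nat.sqrt h + 1))) atTop (𝓝 0) := by
    have h := (tendsto_pow_const_mul_const_pow_of_abs_lt_one (2 * M)
      (by rwa [abs_of_pos h0] : |ρ| < 1)).comp
      ((tendsto_add_atTop_nat 1).comp tendsto_sqrt_atTop)
    simpa using h.const_mul ρ⁻¹
  refine (isLittleO_iff_tendsto' ?_).2 ?_
  · filter_upwards [eventually_ge_atTop 1] with h hh h'
    have : (0 : ℝ) < h := by exact_mod_cast hh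
    exact absurd h' (by positivity)
  · refine squeeze_zero_norm' ?_ hlim
    filter_upwards [eventually_ge_atTop 1] with h hh
    have hh1 : (1 : ℝ) ≤ h := by exact_mod_cast hh
    have hh0 : (0 : ℝ) < h := by linarith
    rw [Real.norm_of_nonneg (by positivity), Real.rpow_neg hh0.le, div_inv_eq_mul, pow_succ ρ]
    -- Since `h < (⌊√h⌋ + 1)²`, the claim becomes polynomial against exponential growth in `⌊√h⌋ +
    -- 1`.
    have e1 : (h : ℝ) ^ ν ≤ ((Nat.sqrt h + 1 : ℕ) : ℝ) ^ (2 * M) := by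
      calc (h : ℝ) ^ ν ≤ (h : ℝ) ^ (M : ℝ) := Real.rpow_le_rpow_of_exponent_le hh1 hM
        _ = (h : ℝ) ^ M := Real.rpow_natCast _ _
        _ ≤ (((Nat.sqrt h + 1 : ℕ) : ℝ) ^ 2) ^ M := by
            gcongr
            have := (Nat.lt_succ_sqrt' h).le
            exact_mod_cast this
        _ = _ := by rw [pow_mul]
    calc ρ ^ Nat.sqrt h * (h : ℝ) ^ ν ≤ ρ ^ Nat.sqrt h * ((Nat.sqrt h + 1 : ℕ) : ℝ) ^ (2 * M) := by
          gcongr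
      _ = _ := by field_simp

/-- The window of summation in `𝒢`. -/
abbrev window (h : ℕ) : Finset ℤ :=
  Finset.Icc (-((Nat.sqrt h : ℕ) : ℤ)) ((Nat.sqrt h : ℕ) : ℤ)

/-- With `ρ = τ²`, one factor `τ^|k|` keeps the tail summable and the other is at most `τ^⌊√h⌋`
outside the window. Of `w` only boundedness is used. -/
theorem sub_truncated_isLittleO {A w : ℤ → ℝ} {S : ℕ → ℝ} (hA : GeomDecay A) {B : ℝ}
    (hw : ∀ n, |w n| ≤ B) (hS : ∀ h : ℕ, HasSum (fun k => A k * w (h - k)) (S h)) (ν : ℝ) :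
    (fun h : ℕ => S h - ∑ k ∈ window h, A k * w (h - k)) =o[atTop]
      fun h : ℕ => (h : ℝ) ^ (-ν) := by
  obtain ⟨C, ρ, h0, h1, hA⟩ := hA
  have hC : 0 ≤ C := by simpa using (abs_nonneg _).trans (hA 0)
  have hB : 0 ≤ B := (abs_nonneg _).trans (hw 0)
  set τ := √ρ with hτ
  have hτ0 : 0 < τ := Real.sqrt_pos.2 h0
  have hτ1 : τ < 1 := by rw [hτ, Real.sqrt_lt' one_pos]; simpa using h1
  have hτ2 : ρ = τ * τ := (Real.mul_self_sqrt h0.le).symm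
  refine IsBigO.trans_isLittleO ?_ (pow_sqrt_isLittleO hτ0 hτ1 ν)
  refine IsBigO.of_bound (C * B * ∑' k : ℤ, τ ^ k.natAbs) (.of_forall fun h => ?_)
  have hd : HasSum (fun k => if k ∈ window h then 0 else A k * w (h - k))
      (S h - ∑ k ∈ window h, A k * w (h - k)) := by
    have hf : HasSum (fun k => if k ∈ window h then A k * w (h - k) else 0)
        (∑ k ∈ window h, A k * w (h - k)) := by
      rw [← Finset.sum_congr rfl fun k hk =>
        if_pos (α := ℝ) (c := k ∈ window h) (t := A k * w (h - k)) (e := 0) hk]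
      exact hasSum_sum_of_ne_finset_zero fun k hk => if_neg hk
    refine ((hS h).sub hf).congr_fun fun k => ?_
    split_ifs <;> simp
  rw [← hd.tsum_eq, Real.norm_of_nonneg (by positivity : (0 : ℝ) ≤ τ ^ Nat.sqrt h)]
  have hg := ((summable_pow_natAbs hτ0 hτ1).hasSum.mul_left (C * B)).mul_right (τ ^ Nat.sqrt h)
  refine tsum_of_norm_bounded hg fun k => ?_
  split_ifs with hk
  · rw [norm_zero]; positivity
  · rw [norm_mul]
    have hk' : Nat.sqrt h ≤ k.natAbs := by
      simp only [Finset.mem_Icc, not_and_or, not_le] at hk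
      omega
    calc ‖A k‖ * ‖w (h - k)‖ ≤ C * ρ ^ k.natAbs * B :=
          mul_le_mul (hA k) (hw _) (norm_nonneg _) (by positivity)
      _ = C * B * (τ ^ k.natAbs * τ ^ k.natAbs) := by rw [hτ2, mul_pow]; ring
      _ ≤ C * B * (τ ^ k.natAbs * τ ^ Nat.sqrt h) := by
          gcongr ?_ * (?_ * ?_)
          exact pow_le_pow_of_le_one hτ0.le hτ1.le hk'
      _ = _ := by ring

/-- Because `2⌊√h⌋ ≤ h` for large `h`, the index `h - k` stays comparable to `h`, hence clear of the
poles of the Gamma functions. -/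
theorem eventually_window (N : ℕ) :
    ∀ᶠ h : ℕ in atTop, ∀ k ∈ window h, ∃ n : ℕ,
      (h : ℤ) - k = n ∧ N ≤ n ∧ h ≤ 2 * n ∧ n ≤ 2 * h := by
  filter_upwards [eventually_ge_atTop (2 * N + 4)] with h hh k hk
  have h1 := Nat.sqrt_le h
  have h2 : 2 * Nat.sqrt h ≤ h := by
    rcases le_or_gt 2 (Nat.sqrt h) with h3 | h3
    · nlinarith
    · omega
  rw [Finset.mem_Icc] at hk
  exact ⟨((h : ℤ) - k).toNat, by omega, by omega, by omega, by omega⟩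

/-- An exact identity, with no error term. It allows `κ = 0`, since the quotient on the right is
formed from Gamma functions and not from `w`. -/
theorem eventually_truncated_eq {A w : ℤ → ℝ} {a b κ : ℝ}
    (hw : ∀ n : ℕ, 0 < (n : ℝ) + a → 0 < (n : ℝ) + b → w n = κ * gammaRatio a b n) :
    ∀ᶠ h : ℕ in atTop, ∑ k ∈ window h, A k * w (h - k) =
      w h * ∑ k ∈ window h, A k * (gammaRatio a b ((h : ℝ) - k) / gammaRatio a b h) := by
  obtain ⟨N, hN⟩ := eventually_atTop.1 ((eventually_nat_add_pos a).and (eventually_nat_add_pos b))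
  filter_upwards [eventually_window N, eventually_ge_atTop N] with h hh hNh
  rw [Finset.mul_sum]
  refine Finset.sum_congr rfl fun k hk => ?_
  obtain ⟨n, hn, hNn, -⟩ := hh k hk
  have e : (h : ℝ) - k = n := by exact_mod_cast hn
  rw [hn, e, hw n (hN n hNn).1 (hN n hNn).2, hw h (hN h hNh).1 (hN h hNh).2]
  have := (gammaRatio_pos (hN h hNh).1 (hN h hNh).2).ne'
  field_simp

theorem tendsto_gammaRatio_sub_div (a b : ℝ) (k : ℤ) :
    Tendsto (fun h : ℕ => gammaRatio a b ((h : ℝ) - k) / gammaRatio a b h) atTop (𝓝 1) := by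
  have hk : Tendsto (fun h : ℕ => ((h : ℤ) - k).toNat) atTop atTop := by
    refine tendsto_atTop_atTop.2 fun B => ⟨B + k.natAbs, fun h hh => ?_⟩
    omega
  have h1 := (tendsto_gammaRatio a b).comp hk
  have h2 := h1.div (tendsto_gammaRatio a b) one_ne_zero
  have h3 : Tendsto (fun h : ℕ => (1 - (k : ℝ) / h) ^ (a - b)) atTop (𝓝 1) := by
    have h := (tendsto_const_nhds (x := (1 : ℝ))).sub
      (tendsto_const_div_atTop_nhds_zero_nat (k : ℝ))
    rw [sub_zero] at h
    simpa using h.rpow_const (p := a - b) (Or.inl one_ne_zero)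
  have h4 := h2.mul h3
  rw [div_one, one_mul] at h4
  refine h4.congr' ?_
  filter_upwards [eventually_ge_atTop (k.natAbs + 1)] with h hh
  have e : ((((h : ℤ) - k).toNat : ℕ) : ℝ) = h - k := by
    have : ((((h : ℤ) - k).toNat : ℕ) : ℤ) = h - k := by omega
    exact_mod_cast this
  have hh0 : (0 : ℝ) < h := by
    have : 0 < h := by omega
    exact_mod_cast this
  have hk0 : (0 : ℝ) < (h : ℝ) - k := by
    have : 0 < (h : ℤ) - k := by omega
    exact_mod_cast this
  have e2 : (1 - (k : ℝ) / h) = ((h : ℝ) - k) / h := by field_simp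
  have p1 : ((h : ℝ) - k) ^ (a - b) ≠ 0 := by positivity
  have p2 : (h : ℝ) ^ (a - b) ≠ 0 := by positivity
  simp only [Pi.div_apply, Function.comp_apply]
  rw [e, e2, Real.div_rpow hk0.le hh0.le]
  field_simp

/-- The normalised quotients eventually lie in `(1/2, 2)`, whence the `4`; the factor `2^|a-b|`
bounds `(n/h)^(a-b)` for `n = h - k` with `1/2 ≤ n/h ≤ 2`. -/
theorem eventually_gammaRatio_sub_div_le (a b : ℝ) :
    ∀ᶠ h : ℕ in atTop, ∀ k ∈ window h,
      |gammaRatio a b ((h : ℝ) - k) / gammaRatio a b h| ≤ 4 * 2 ^ |a - b| := by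
  have h1 : ∀ᶠ n : ℕ in atTop, 1 / 2 < gammaRatio a b n / (n : ℝ) ^ (a - b) ∧
      gammaRatio a b n / (n : ℝ) ^ (a - b) < 2 :=
    ((tendsto_gammaRatio a b).eventually_const_lt (by norm_num)).and
      ((tendsto_gammaRatio a b).eventually_lt_const (by norm_num))
  obtain ⟨N, hN⟩ := eventually_atTop.1 h1
  filter_upwards [eventually_window (N + 1), eventually_ge_atTop (N + 1)] with h hh hNh k hk
  obtain ⟨n, hn, hNn, hn1, hn2⟩ := hh k hk
  have e : (h : ℝ) - k = n := by exact_mod_cast hn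
  have hn0 : (0 : ℝ) < n := by
    have : 0 < n := by omega
    exact_mod_cast this
  have hh0 : (0 : ℝ) < h := by
    have : 0 < h := by omega
    exact_mod_cast this
  obtain ⟨-, q2⟩ := hN n (by omega)
  obtain ⟨q3, -⟩ := hN h (by omega)
  obtain ⟨q1, -⟩ := hN n (by omega)
  have p1 : 0 < (n : ℝ) ^ (a - b) := by positivity
  have p2 : 0 < (h : ℝ) ^ (a - b) := by positivity
  rw [div_lt_iff₀ p1] at q2
  rw [lt_div_iff₀ p1] at q1
  rw [lt_div_iff₀ p2] at q3
  have g1 : 0 < gammaRatio a b n := by nlinarith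
  have g2 : 0 < gammaRatio a b h := by nlinarith
  have hr : (n : ℝ) ^ (a - b) ≤ 2 ^ |a - b| * (h : ℝ) ^ (a - b) := by
    rw [← div_le_iff₀ p2, ← Real.div_rpow hn0.le hh0.le]
    rcases le_total 0 (a - b) with hp | hp
    · rw [abs_of_nonneg hp]
      refine Real.rpow_le_rpow (by positivity) ?_ hp
      rw [div_le_iff₀ hh0]
      exact_mod_cast hn2
    · rw [abs_of_nonpos hp, ← inv_div, Real.inv_rpow (by positivity),
        ← Real.rpow_neg (by positivity)]
      refine Real.rpow_le_rpow (by positivity) ?_ (by linarith)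
      rw [div_le_iff₀ hn0]
      exact_mod_cast hn1
  rw [e, abs_of_pos (div_pos g1 g2), div_le_iff₀ g2]
  have p3 : (0 : ℝ) < 2 ^ |a - b| := by positivity
  nlinarith [mul_lt_mul_of_pos_left q3 p3]

theorem tendsto_sum_window {A : ℤ → ℝ} (hA : Summable A) (a b : ℝ) :
    Tendsto (fun h : ℕ => ∑ k ∈ window h,
      A k * (gammaRatio a b ((h : ℝ) - k) / gammaRatio a b h)) atTop (𝓝 (∑' k, A k)) := by
  have h := tendsto_tsum_of_dominated_convergence (𝓕 := atTop)
    (f := fun (h : ℕ) k => if k ∈ window h then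
      A k * (gammaRatio a b ((h : ℝ) - k) / gammaRatio a b h) else 0) (g := A)
    (hA.abs.mul_right (4 * 2 ^ |a - b|)) ?_ ?_
  · refine h.congr fun h => ?_
    rw [tsum_eq_sum (s := window h) fun k hk => if_neg hk]
    exact Finset.sum_congr rfl fun k hk => if_pos hk
  · intro k
    have h1 := (tendsto_gammaRatio_sub_div a b k).const_mul (A k)
    rw [mul_one] at h1
    refine h1.congr' ?_
    filter_upwards [tendsto_sqrt_atTop.eventually_ge_atTop k.natAbs] with h hh
    rw [if_pos (Finset.mem_Icc.2 ⟨by omega, by omega⟩)]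
  · filter_upwards [eventually_gammaRatio_sub_div_le a b] with h hh k
    split_ifs with hk
    · rw [norm_mul]
      exact mul_le_mul_of_nonneg_left (hh k hk) (norm_nonneg _)
    · rw [norm_zero]; positivity

/-! ### The coefficients `λ_{d,k}` and the functions `𝒢` and `𝒦` -/

theorem seasCoeff_mul {s : ℕ} (hs : 0 < s) (d : ℝ) (m : ℕ) :
    seasCoeff s d (s * m) = fracCoeff d m := by
  simp [seasCoeff, Nat.mul_div_cancel_left m hs]

theorem extendZ_seasCoeff_of_not_dvd {s : ℕ} {n : ℤ} (d : ℝ) (hn : ¬ (s : ℤ) ∣ n) :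
    extendZ (seasCoeff s d) n = 0 := by
  rcases lt_or_ge n 0 with h | h
  · exact extendZ_of_neg _ h
  · lift n to ℕ using h
    rw [extendZ_natCast, seasCoeff, if_neg (by exact_mod_cast hn)]

theorem summable_seasCoeff_sq {s : ℕ} (hs : 0 < s) {d : ℝ} (hd : d < 1 / 2) :
    Summable fun i => extendZ (seasCoeff s d) i ^ 2 := by
  simpa [sq] using (hasSum_seasCoeff_mul hs hd 0).summable

theorem hasSum_residue {A W : ℤ → ℝ} {s : ℕ} (hs : 0 < s) (hW : ∀ n, ¬ (s : ℤ) ∣ n → W n = 0)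
    {h : ℤ} {r : ℕ} {x : ℝ} (hx : HasSum (fun a => A a * W ((s : ℤ) * h + r - a)) x) :
    HasSum (fun k : ℤ => A ((s : ℤ) * k + r) * W ((s : ℤ) * h - (s : ℤ) * k)) x := by
  have inj : Function.Injective fun k : ℤ => (s : ℤ) * k + r := fun a b hab => by
    have hs' : (s : ℤ) ≠ 0 := by omega
    exact mul_left_cancel₀ hs' (add_right_cancel hab)
  refine ((inj.hasSum_iff ?_).2 hx).congr_fun fun k => ?_
  · intro a ha
    rw [hW, mul_zero]
    rintro ⟨c, hc⟩
    exact ha ⟨h - c, by simp only; linear_combination hc⟩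
  · simp only [Function.comp_apply]
    rw [add_sub_add_right_eq_sub]

theorem hasSum_lamCoeff (α β : Polynomial ℝ) (s : ℕ) (d : ℝ) (k : ℤ) :
    HasSum (fun a : ℤ => extendZ (armaCoeff α β) a * extendZ (seasCoeff s d) (k - a))
      (extendZ (lamCoeff α β s d) k) := by
  have h := hasSum_extendZ_coeff_mul ((α : PowerSeries ℝ) * (β : PowerSeries ℝ)⁻¹)
    (PowerSeries.mk (seasCoeff s d)) k
  simp only [PowerSeries.coeff_mk] at h
  exact h

/-- As `γ_V` is `v` times an autocorrelation, its modulus is at most `|v|` times the sum of squares,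
by `|xy| ≤ (x² + y²)/2`. -/
theorem abs_gammaV_le {s : ℕ} (hs : 0 < s) {d : ℝ} (hd : d < 1 / 2) (v : ℝ) (m : ℤ) :
    |gammaV s d v m| ≤ |v| * ∑' i, extendZ (seasCoeff s d) i ^ 2 := by
  have h1 := (summable_seasCoeff_sq hs hd).hasSum
  have h2 := ((h1.add ((Equiv.addRight m).hasSum_iff.2 h1)).mul_left (1 / 2))
  rw [← two_mul, ← mul_assoc, one_div_mul_cancel two_ne_zero, one_mul] at h2
  rw [gammaV_eq_mul, abs_mul, ← (hasSum_seasCoeff_mul hs hd m).tsum_eq]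
  refine mul_le_mul_of_nonneg_left ?_ (abs_nonneg v)
  rw [← Real.norm_eq_abs]
  refine tsum_of_norm_bounded h2 fun i => ?_
  rw [norm_mul, Real.norm_eq_abs, Real.norm_eq_abs]
  simp only [Function.comp_apply, Equiv.coe_addRight]
  generalize extendZ (seasCoeff s d) i = x
  generalize extendZ (seasCoeff s d) (i + m) = y
  rw [← sq_abs x, ← sq_abs y]
  nlinarith [sq_nonneg (|x| - |y|)]

theorem mul_add_div_of_lt {s h r : ℕ} (hr : r < s) : (s * h + r) / s = h := by
  rw [Nat.mul_add_div (by omega), Nat.div_eq_of_lt hr, Nat.add_zero]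

theorem mul_add_mod_of_lt {s h r : ℕ} (hr : r < s) : (s * h + r) % s = r := by
  rw [Nat.mul_add_mod, Nat.mod_eq_of_lt hr]

theorem scrG_eq_window (α β : Polynomial ℝ) {s : ℕ} (d : ℝ) (h : ℕ) {r : ℕ} (hr : r < s) :
    scrG α β s d (s * h + r) = ∑ k ∈ window h, gammaA α β ((s : ℤ) * k + (r : ℤ)) *
      (gammaRatio d (1 - d) ((h : ℝ) - k) / gammaRatio d (1 - d) h) := by
  rw [scrG, mul_add_div_of_lt hr, mul_add_mod_of_lt hr]
  refine Finset.sum_congr rfl fun k _ => ?_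
  rw [gammaRatio, gammaRatio, div_div_div_eq, add_sub_assoc, add_sub_assoc]

theorem scrK_eq_window (α β : Polynomial ℝ) {s : ℕ} (d : ℝ) (h : ℕ) {r : ℕ} (hr : r < s) :
    scrK α β s d (s * h + r) = ∑ k ∈ window h, extendZ (armaCoeff α β) ((s : ℤ) * k + (r : ℤ)) *
      (gammaRatio d 1 ((h : ℝ) - k) / gammaRatio d 1 h) := by
  rw [scrK, mul_add_div_of_lt hr, mul_add_mod_of_lt hr]
  have hsub : (Finset.range (Nat.sqrt h + 1)).map Nat.castEmbedding ⊆ window h := by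
    intro k hk
    simp only [Finset.mem_map, Finset.mem_range, Nat.castEmbedding_apply] at hk
    obtain ⟨j, hj, rfl⟩ := hk
    exact Finset.mem_Icc.2 ⟨by omega, by omega⟩
  rw [← Finset.sum_subset hsub, Finset.sum_map]
  · refine Finset.sum_congr rfl fun j _ => ?_
    have e : ((s : ℤ) * (j : ℤ) + (r : ℤ)) = ((s * j + r : ℕ) : ℤ) := by push_cast; rfl
    rw [Nat.castEmbedding_apply, e, extendZ_natCast, gammaRatio, gammaRatio, div_div_div_eq]
    push_cast
    rfl
  -- The window is symmetric while `𝒦` sums over `j ≥ 0`: for `k ≤ -1` and `r < s` the index `sk +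
  -- r` is negative, where the extended `f` vanishes.
  · intro k hk hk'
    have hk0 : k < 0 := by
      by_contra h0
      refine hk' ?_
      simp only [Finset.mem_map, Finset.mem_range, Nat.castEmbedding_apply]
      rw [Finset.mem_Icc] at hk
      exact ⟨k.toNat, by omega, by omega⟩
    rw [extendZ_of_neg, zero_mul]
    have : (s : ℤ) * k ≤ (s : ℤ) * (-1) := mul_le_mul_of_nonneg_left (by omega) (by omega)
    omega

theorem sum_range_tsum_residue {A : ℤ → ℝ} (hA : Summable A) {s : ℕ} (hs : 0 < s) :
    ∑ r ∈ Finset.range s, ∑' k : ℤ, A ((s : ℤ) * k + (r : ℤ)) = ∑' m, A m := by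
  have : NeZero s := ⟨hs.ne'⟩
  have h1 : HasSum (fun x : ℤ × Fin s => A ((s : ℤ) * x.1 + ((x.2 : ℕ) : ℤ))) (∑' m, A m) := by
    refine ((Int.divModEquiv s).symm.hasSum_iff.2 hA.hasSum).congr_fun fun x => ?_
    simp [Int.divModEquiv, mul_comm]
  have h2 := (Equiv.prodComm (Fin s) ℤ).hasSum_iff.2 h1
  have h3 := h2.prod_fiberwise fun r => (h2.summable.prod_factor r).hasSum
  rw [Finset.sum_range]
  exact (h3.unique (hasSum_fintype _)).symm

theorem exists_hasSum_lamCoeff_mul {α β : Polynomial ℝ} (hβ0 : β.coeff 0 = 1)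
    (hβ : ∀ z : ℂ, ‖z‖ ≤ 1 → Polynomial.aeval z β ≠ 0)
    {s : ℕ} (hs : 0 < s) {d : ℝ} (hd : d < 1 / 2) (m : ℤ) :
    ∃ T, HasSum (fun k => extendZ (lamCoeff α β s d) k * extendZ (lamCoeff α β s d) (k + m)) T ∧
      HasSum (fun j => gammaA α β j * gammaV s d 1 (m - j)) T :=
  exists_hasSum_autocov_convolution (geomDecay_extendZ_arma α β hβ0 hβ).summable
    (summable_seasCoeff_sq hs hd) (hasSum_lamCoeff α β s d)
    (fun j => hasSum_extendZ_mul j (hasSum_gammaA α β hβ0 hβ j)) (hasSum_seasCoeff_mul hs hd) m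

theorem summable_lamCoeff_sq {α β : Polynomial ℝ} (hβ0 : β.coeff 0 = 1)
    (hβ : ∀ z : ℂ, ‖z‖ ≤ 1 → Polynomial.aeval z β ≠ 0)
    {s : ℕ} (hs : 0 < s) {d : ℝ} (hd : d < 1 / 2) :
    Summable fun k => lamCoeff α β s d k ^ 2 := by
  obtain ⟨T, hT, -⟩ := exists_hasSum_lamCoeff_mul hβ0 hβ hs hd 0
  rw [hasSum_int_iff_of_neg fun n hn => by rw [extendZ_of_neg _ hn, zero_mul]] at hT
  simpa [sq] using hT.summable

theorem lamCoeff_sub_isLittleO {α β : Polynomial ℝ} (hβ0 : β.coeff 0 = 1)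
    (hβ : ∀ z : ℂ, ‖z‖ ≤ 1 → Polynomial.aeval z β ≠ 0)
    {s : ℕ} (hs : 0 < s) {d : ℝ} (hd : d < 1 / 2) (ν : ℝ) {r : ℕ}
    (hr : r < s) :
    (fun k : ℕ => lamCoeff α β s d (s * k + r) -
        seasCoeff s d (s * k) * scrK α β s d (s * k + r))
      =o[atTop] fun k : ℕ => (k : ℝ) ^ (-ν) := by
  obtain ⟨κ, hκ⟩ := exists_fracCoeff_eq d
  set w : ℤ → ℝ := fun n => extendZ (seasCoeff s d) ((s : ℤ) * n) with hw
  have hwn : ∀ n : ℕ, w n = seasCoeff s d (s * n) := fun n => by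
    rw [hw, ← extendZ_natCast (seasCoeff s d)]
    push_cast
    rfl
  -- Boundedness comes from square summability through `|x| ≤ 1 + x²`.
  have hb : ∀ n, |w n| ≤ 1 + ∑' i, extendZ (seasCoeff s d) i ^ 2 := fun n => by
    have h1 := (summable_seasCoeff_sq hs hd).le_tsum ((s : ℤ) * n) fun _ _ => sq_nonneg _
    have h2 : |w n| ≤ 1 + w n ^ 2 := by
      rw [← sq_abs]
      nlinarith [sq_nonneg (|w n| - 1), abs_nonneg (w n)]
    exact h2.trans (by linarith)
  have h := sub_truncated_isLittleO ((geomDecay_extendZ_arma α β hβ0 hβ).comp_mul_add hs r) hb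
    (S := fun k => lamCoeff α β s d (s * k + r)) (fun h => by
      have h1 := hasSum_residue (h := h) (r := r) hs (fun n => extendZ_seasCoeff_of_not_dvd d)
        (hasSum_lamCoeff α β s d ((s : ℤ) * h + r))
      have e : ((s : ℤ) * (h : ℤ) + (r : ℤ)) = ((s * h + r : ℕ) : ℤ) := by push_cast; rfl
      rw [e, extendZ_natCast] at h1
      simpa only [hw, mul_sub] using h1) ν
  refine h.congr' ?_ EventuallyEq.rfl
  filter_upwards [eventually_truncated_eq (A := fun k => extendZ (armaCoeff α β) ((s : ℤ) * k + r))
    (w := w) (a := d) (b := 1) (κ := κ) fun n hn _ => by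
      rw [hwn, seasCoeff_mul hs, hκ n hn]] with h hh
  rw [hh, hwn, scrK_eq_window α β d h hr]

theorem autocov_sub_isLittleO {α β : Polynomial ℝ} (hβ0 : β.coeff 0 = 1)
    (hβ : ∀ z : ℂ, ‖z‖ ≤ 1 → Polynomial.aeval z β ≠ 0)
    {s : ℕ} (hs : 0 < s) {d : ℝ} (hd : d < 1 / 2) (v ν : ℝ) {r : ℕ}
    {S : ℕ → ℝ} (hS : ∀ h : ℕ, HasSum (fun k : ℤ => gammaA α β ((s : ℤ) * k + (r : ℤ)) *
      gammaV s d v ((s : ℤ) * h - (s : ℤ) * k)) (S h)) (hr : r < s) :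
    (fun h : ℕ => S h - gammaV s d v ((s : ℤ) * (h : ℤ)) * scrG α β s d (s * h + r))
      =o[atTop] fun h : ℕ => (h : ℝ) ^ (-ν) := by
  obtain ⟨κ, hκ⟩ := exists_ascPochhammer_eq d
  set w : ℤ → ℝ := fun n => gammaV s d v ((s : ℤ) * n) with hw
  have h := sub_truncated_isLittleO ((geomDecay_gammaA α β hβ0 hβ).comp_mul_add hs r)
    (w := w) (fun n => abs_gammaV_le hs hd v _) (S := S)
    (fun h => by simpa only [hw, mul_sub] using hS h) ν
  refine h.congr' ?_ EventuallyEq.rfl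
  filter_upwards [eventually_truncated_eq (A := fun k => gammaA α β ((s : ℤ) * k + r))
    (w := w) (a := d) (b := 1 - d) (κ := v * (Real.Gamma (1 - 2 * d) * κ / Real.Gamma (1 - d)))
    fun n hn _ => by
      simp only [hw]
      rw [gammaV_mul_natCast hs, hκ n hn, gammaRatio, add_comm (1 - d)]
      ring] with h hh
  rw [hh, scrG_eq_window α β d h hr]

theorem tendsto_sum_scrG {α β : Polynomial ℝ} (hβ0 : β.coeff 0 = 1)
    (hβ : ∀ z : ℂ, ‖z‖ ≤ 1 → Polynomial.aeval z β ≠ 0)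
    {s : ℕ} (hs : 0 < s) (d : ℝ) :
    Tendsto (fun h : ℕ => ∑ r ∈ Finset.range s, scrG α β s d (s * h + r)) atTop
      (𝓝 (∑' m : ℤ, gammaA α β m)) := by
  have hA := geomDecay_gammaA α β hβ0 hβ
  rw [← sum_range_tsum_residue hA.summable hs]
  refine tendsto_finsetSum _ fun r hr => ?_
  refine (tendsto_sum_window (hA.comp_mul_add hs r).summable d (1 - d)).congr fun h => ?_
  rw [scrG_eq_window α β d h (Finset.mem_range.1 hr)]

theorem tendsto_sum_scrK {α β : Polynomial ℝ} (hβ0 : β.coeff 0 = 1)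
    (hβ : ∀ z : ℂ, ‖z‖ ≤ 1 → Polynomial.aeval z β ≠ 0)
    {s : ℕ} (hs : 0 < s) (d : ℝ) :
    Tendsto (fun k : ℕ => ∑ r ∈ Finset.range s, scrK α β s d (s * k + r)) atTop
      (𝓝 (α.eval 1 / β.eval 1)) := by
  have hA := geomDecay_extendZ_arma α β hβ0 hβ
  rw [← (hasSum_extendZ_iff.2 (hasSum_armaCoeff α β hβ0 hβ)).tsum_eq,
    ← sum_range_tsum_residue hA.summable hs]
  refine tendsto_finsetSum _ fun r hr => ?_
  refine (tendsto_sum_window (hA.comp_mul_add hs r).summable d 1).congr fun h => ?_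
  rw [scrK_eq_window α β d h (Finset.mem_range.1 hr)]

/-! ### Orthogonal series in `L²` -/

theorem summable_of_pairwise_inner_eq_zero {E : Type*} [NormedAddCommGroup E]
    [InnerProductSpace ℝ E] [CompleteSpace E] {x : ℕ → E}
    (hx : Pairwise fun i j => inner ℝ (x i) (x j) = 0) (hs : Summable fun i => ‖x i‖ ^ 2) :
    Summable x := by
  have hV : OrthogonalFamily ℝ (fun i => Submodule.span ℝ {x i})
      fun i => (Submodule.span ℝ {x i}).subtypeₗᵢ := by
    refine OrthogonalFamily.of_pairwise fun i j hij => ?_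
    refine Submodule.isOrtho_span.2 ?_
    rintro u rfl w rfl
    exact hx hij
  exact (hV.summable_iff_norm_sq_summable
    (fun i => ⟨x i, Submodule.mem_span_singleton_self _⟩)).2 hs

/-- The series converges in `L²` by orthogonality. Its `L²` sum and the almost sure limit are both
limits in measure of the same partial sums, so they agree; continuity of the inner product then
gives termwise integration against `W`. -/
theorem orthogonal_series_ae_limit {Ω : Type*} [MeasurableSpace Ω] {P : Measure Ω}
    [IsProbabilityMeasure P] {ξ : ℕ → Ω → ℝ} {Y : Ω → ℝ} (hξ : ∀ k, MemLp (ξ k) 2 P)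
    (horth : Pairwise fun i j => ∫ x, ξ i x * ξ j x ∂P = 0)
    (hs : Summable fun k => ∫ x, ξ k x * ξ k x ∂P)
    (hY : ∀ᵐ x ∂P, Tendsto (fun n => ∑ k ∈ Finset.range n, ξ k x) atTop (𝓝 (Y x))) :
    MemLp Y 2 P ∧ ∀ W : Ω → ℝ, MemLp W 2 P →
      HasSum (fun k => ∫ x, ξ k x * W x ∂P) (∫ x, Y x * W x ∂P) := by
  have hin : ∀ {f g : Ω → ℝ} (hf : MemLp f 2 P) (hg : MemLp g 2 P),
      inner ℝ (hf.toLp f) (hg.toLp g) = ∫ x, f x * g x ∂P := fun hf hg => by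
    rw [L2.inner_def]
    refine integral_congr_ae ?_
    filter_upwards [hf.coeFn_toLp, hg.coeFn_toLp] with x h1 h2
    rw [h1, h2]
    simp [mul_comm]
  set x : ℕ → Lp ℝ 2 P := fun k => (hξ k).toLp (ξ k) with hx
  have hsx : Summable x := by
    refine summable_of_pairwise_inner_eq_zero (fun i j hij => ?_) (hs.congr fun k => ?_)
    · exact (hin (hξ i) (hξ j)).trans (horth hij)
    · rw [← real_inner_self_eq_norm_sq]
      exact (hin (hξ k) (hξ k)).symm
  obtain ⟨S, hS⟩ := hsx
  have hmS : TendstoInMeasure P (fun n ω => ∑ k ∈ Finset.range n, ξ k ω) atTop S := by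
    refine (tendstoInMeasure_of_tendsto_Lp hS.tendsto_sum_nat).congr_left fun n => ?_
    have h1 : ∀ᵐ ω ∂P, ∀ k, x k ω = ξ k ω := ae_all_iff.2 fun k => (hξ k).coeFn_toLp
    filter_upwards [Lp.coeFn_fun_finsetSum (Finset.range n) x, h1] with ω h2 h3
    rw [h2]
    simp [h3]
  have hmY : TendstoInMeasure P (fun n ω => ∑ k ∈ Finset.range n, ξ k ω) atTop Y :=
    tendstoInMeasure_of_tendsto_ae
      (fun n => Finset.aestronglyMeasurable_fun_sum _ fun k _ => (hξ k).1) hY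
  have hSY : S =ᵐ[P] Y := tendstoInMeasure_ae_unique hmS hmY
  have hYm : MemLp Y 2 P := (memLp_congr_ae hSY).1 (Lp.memLp S)
  have hSe : S = hYm.toLp Y := Lp.ext (hSY.trans hYm.coeFn_toLp.symm)
  refine ⟨hYm, fun W hW => ?_⟩
  have h := hS.mapL (innerSL ℝ (hW.toLp W))
  simp only [innerSL_apply_apply] at h
  rw [hSe, hin] at h
  simp only [hx, hin] at h
  simpa only [mul_comm] using h

/-! ### Second moments of the process -/

theorem covariance_congr_ae {Ω : Type*} [MeasurableSpace Ω] {P : Measure Ω} {X X' Y Y' : Ω → ℝ}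
    (hX : X =ᵐ[P] X') (hY : Y =ᵐ[P] Y') : covariance X Y P = covariance X' Y' P := by
  rw [covariance, covariance, integral_congr_ae hX, integral_congr_ae hY]
  refine integral_congr_ae ?_
  filter_upwards [hX, hY] with x h1 h2
  rw [h1, h2]

namespace IsSFIEGARCH

variable {Ω : Type*} [MeasurableSpace Ω] {P : Measure Ω}
  {α β : Polynomial ℝ} {s : ℕ} {d ω θ γ : ℝ} {Z σ X : ℤ → Ω → ℝ}

theorem gZ_eq (hX : IsSFIEGARCH P α β s d ω θ γ Z σ X) (t : ℤ) :
    gZ P Z θ γ t = (fun y => θ * y + γ * (|y| - ∫ x, |Z 0 x| ∂P)) ∘ Z t := by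
  have h : ∫ x, |Z t x| ∂P = ∫ x, |Z 0 x| ∂P :=
    ((hX.ident_Z t).comp (u := fun y : ℝ => |y|) measurable_norm).integral_eq
  ext x
  simp [gZ, h]

theorem identDistrib_comp (hX : IsSFIEGARCH P α β s d ω θ γ Z σ X) {φ : ℝ → ℝ} (hφ : Measurable φ)
    (t : ℤ) : IdentDistrib (φ ∘ Z t) (φ ∘ Z 0) P P := (hX.ident_Z t).comp hφ

theorem covariance_comp [IsProbabilityMeasure P]
    (hX : IsSFIEGARCH P α β s d ω θ γ Z σ X) {φ ψ : ℝ → ℝ} (hφ : Measurable φ)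
    (hψ : Measurable ψ) (hφ2 : MemLp (φ ∘ Z 0) 2 P) (hψ2 : MemLp (ψ ∘ Z 0) 2 P) (t u : ℤ) :
    covariance (φ ∘ Z t) (ψ ∘ Z u) P =
      if t = u then covariance (φ ∘ Z 0) (ψ ∘ Z 0) P else 0 := by
  split_ifs with h
  · subst h
    rw [← covariance_map hφ.aestronglyMeasurable hψ.aestronglyMeasurable
      (hX.measurable_Z t).aemeasurable, (hX.ident_Z t).map_eq,
      covariance_map hφ.aestronglyMeasurable hψ.aestronglyMeasurable
      (hX.measurable_Z 0).aemeasurable]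
  · exact ((hX.indep_Z.indepFun h).comp hφ hψ).covariance_eq_zero
      ((hX.identDistrib_comp hφ t).memLp_iff.2 hφ2) ((hX.identDistrib_comp hψ u).memLp_iff.2 hψ2)

theorem measurable_g (m : ℝ) : Measurable fun y : ℝ => θ * y + γ * (|y| - m) := by
  fun_prop

theorem measurable_logSq : Measurable fun y : ℝ => Real.log (y ^ 2) := by
  fun_prop

theorem memLp_gZ [IsProbabilityMeasure P]
    (hX : IsSFIEGARCH P α β s d ω θ γ Z σ X) (t : ℤ) :
    MemLp (gZ P Z θ γ t) 2 P := by
  have h : MemLp (Z t) 2 P := (hX.ident_Z t).memLp_iff.2 hX.memLp_Z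
  exact (h.const_mul θ).add ((h.abs.sub (memLp_const _)).const_mul γ)

theorem integral_gZ [IsProbabilityMeasure P]
    (hX : IsSFIEGARCH P α β s d ω θ γ Z σ X) (t : ℤ) :
    ∫ x, gZ P Z θ γ t x ∂P = 0 := by
  have h : Integrable (Z t) P :=
    ((hX.ident_Z t).memLp_iff.2 hX.memLp_Z).integrable one_le_two
  have h0 : ∫ x, Z t x ∂P = 0 := (hX.ident_Z t).integral_eq.trans hX.mean_Z
  have h1 : Integrable (fun x => |Z t x| - ∫ y, |Z t y| ∂P) P := h.abs.sub (integrable_const _)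
  simp only [gZ]
  rw [integral_add (h.const_mul θ) (h1.const_mul γ),
    integral_const_mul, integral_const_mul, integral_sub h.abs (integrable_const _), h0]
  simp

theorem covariance_gZ [IsProbabilityMeasure P]
    (hX : IsSFIEGARCH P α β s d ω θ γ Z σ X) (t u : ℤ) :
    covariance (gZ P Z θ γ t) (gZ P Z θ γ u) P =
      if t = u then variance (gZ P Z θ γ 0) P else 0 := by
  have h := hX.memLp_gZ 0
  rw [← covariance_self h.1.aemeasurable]
  rw [hX.gZ_eq] at h
  rw [hX.gZ_eq, hX.gZ_eq, hX.gZ_eq]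
  exact hX.covariance_comp (measurable_g _) (measurable_g _) h h t u

theorem memLp_logSq_Z [IsProbabilityMeasure P]
    (hX : IsSFIEGARCH P α β s d ω θ γ Z σ X) (hvar : MemLp (logSq Z 0) 2 P)
    (t : ℤ) : MemLp (logSq Z t) 2 P :=
  (hX.identDistrib_comp measurable_logSq t).memLp_iff.2 hvar

theorem integral_logSq_Z [IsProbabilityMeasure P]
    (hX : IsSFIEGARCH P α β s d ω θ γ Z σ X) (t : ℤ) :
    ∫ x, logSq Z t x ∂P = ∫ x, logSq Z 0 x ∂P :=
  (hX.identDistrib_comp measurable_logSq t).integral_eq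

theorem covariance_logSq_Z [IsProbabilityMeasure P]
    (hX : IsSFIEGARCH P α β s d ω θ γ Z σ X)
    (hvar : MemLp (logSq Z 0) 2 P) (t u : ℤ) :
    covariance (logSq Z t) (logSq Z u) P = if t = u then variance (logSq Z 0) P else 0 := by
  rw [← covariance_self hvar.1.aemeasurable]
  exact hX.covariance_comp measurable_logSq measurable_logSq hvar hvar t u

theorem covariance_gZ_logSq_Z [IsProbabilityMeasure P]
    (hX : IsSFIEGARCH P α β s d ω θ γ Z σ X)
    (hvar : MemLp (logSq Z 0) 2 P) (t u : ℤ) :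
    covariance (gZ P Z θ γ t) (logSq Z u) P =
      if t = u then covariance (gZ P Z θ γ 0) (logSq Z 0) P else 0 := by
  have h := hX.memLp_gZ 0
  rw [hX.gZ_eq] at h
  rw [hX.gZ_eq, hX.gZ_eq]
  exact hX.covariance_comp (measurable_g _) measurable_logSq h hvar t u

theorem integral_gZ_mul [IsProbabilityMeasure P]
    (hX : IsSFIEGARCH P α β s d ω θ γ Z σ X) (t : ℤ) {W : Ω → ℝ}
    (hW : MemLp W 2 P) : ∫ x, gZ P Z θ γ t x * W x ∂P = covariance (gZ P Z θ γ t) W P := by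
  rw [covariance_eq_sub (hX.memLp_gZ t) hW, hX.integral_gZ, zero_mul, sub_zero]
  rfl

theorem logSq_sigma_expansion [IsProbabilityMeasure P]
    (hX : IsSFIEGARCH P α β s d ω θ γ Z σ X) (hd : d < 1 / 2) (t : ℤ) :
    MemLp (logSq σ t) 2 P ∧ ∫ x, logSq σ t x ∂P = ω ∧ ∀ W : Ω → ℝ, MemLp W 2 P →
      HasSum (fun k : ℕ => lamCoeff α β s d k * covariance (gZ P Z θ γ (t - 1 - (k : ℤ))) W P)
        (covariance (logSq σ t) W P) := by
  set ξ : ℕ → Ω → ℝ := fun k x => lamCoeff α β s d k * gZ P Z θ γ (t - 1 - (k : ℤ)) x with hξ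
  have hm : ∀ k, MemLp (ξ k) 2 P := fun k => (hX.memLp_gZ _).const_mul _
  have hint : ∀ i j, ∫ x, ξ i x * ξ j x ∂P = lamCoeff α β s d i * lamCoeff α β s d j *
      if i = j then variance (gZ P Z θ γ 0) P else 0 := fun i j => by
    have h := hX.integral_gZ_mul (t - 1 - (i : ℤ)) (hX.memLp_gZ (t - 1 - (j : ℤ)))
    rw [hX.covariance_gZ] at h
    simp only [sub_right_inj, Nat.cast_inj] at h
    rw [← h, ← integral_const_mul]
    refine integral_congr_ae (.of_forall fun x => ?_)
    simp only [hξ]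
    ring
  obtain ⟨h1, h2⟩ := orthogonal_series_ae_limit (P := P) (Y := fun x => logSq σ t x - ω) hm
    (fun i j hij => (hint i j).trans (by rw [if_neg hij, mul_zero]))
    (by
      refine ((summable_lamCoeff_sq (α := α) hX.coeff_zero_beta hX.beta_ne_zero hX.s_pos
        hd).mul_right
        (variance (gZ P Z θ γ 0) P)).congr fun k => ?_
      rw [hint, if_pos rfl, sq])
    (by
      filter_upwards [hX.log_sigma_sq t] with x hx
      simpa [hξ, logSq] using hx.sub_const ω)
  have hL : MemLp (logSq σ t) 2 P := by
    refine (memLp_congr_ae (.of_forall fun x => ?_)).1 (h1.add (memLp_const ω))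
    simp
  have hmean : ∫ x, logSq σ t x ∂P = ω := by
    -- Testing against the constant `1` yields the mean, every `g(Z_u)` being centred.
    have h3 := h2 (fun _ => 1) (memLp_const 1)
    simp only [mul_one, hξ, integral_const_mul, hX.integral_gZ, mul_zero] at h3
    have h4 := h3.unique hasSum_zero
    rw [integral_sub (hL.integrable one_le_two) (integrable_const ω)] at h4
    simpa [sub_eq_zero] using h4
  refine ⟨hL, hmean, fun W hW => ?_⟩
  have h3 := h2 W hW
  have h5 : covariance (logSq σ t) W P = ∫ x, (logSq σ t x - ω) * W x ∂P := by
    rw [← covariance_sub_const_left (hL.integrable one_le_two) ω, covariance_eq_sub h1 hW,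
      integral_sub (hL.integrable one_le_two) (integrable_const ω), hmean]
    simp
  rw [h5]
  refine h3.congr_fun fun k => ?_
  rw [← hX.integral_gZ_mul _ hW, ← integral_const_mul]
  simp only [hξ, mul_assoc]

/-- Only the innovation with `t - 1 - k = u` correlates with `W u`. The zero extension encodes
causality: the covariance vanishes for `u ≥ t`. It is used both for `W = g(Z)` and for `W = ln Z²`.
-/
theorem covariance_logSq_sigma [IsProbabilityMeasure P]
    (hX : IsSFIEGARCH P α β s d ω θ γ Z σ X) (hd : d < 1 / 2)
    {W : ℤ → Ω → ℝ} (hW : ∀ u, MemLp (W u) 2 P) {c : ℝ}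
    (hc : ∀ t u, covariance (gZ P Z θ γ t) (W u) P = if t = u then c else 0) (t u : ℤ) :
    covariance (logSq σ t) (W u) P = c * extendZ (lamCoeff α β s d) (t - 1 - u) := by
  have h := (hX.logSq_sigma_expansion hd t).2.2 (W u) (hW u)
  simp only [hc] at h
  refine h.unique ?_
  rcases lt_or_ge (t - 1 - u) 0 with hn | hn
  · rw [extendZ_of_neg _ hn, mul_zero]
    refine hasSum_zero.congr_fun fun k => ?_
    rw [if_neg (by omega), mul_zero]
  · obtain ⟨n, hn⟩ := Int.eq_ofNat_of_zero_le hn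
    rw [hn, extendZ_natCast, mul_comm]
    have h1 := hasSum_single (f := fun k : ℕ => lamCoeff α β s d k *
      if t - 1 - (k : ℤ) = u then c else 0) n fun k hk => by
        rw [if_neg (by omega), mul_zero]
    simpa [show t - 1 - (n : ℤ) = u by omega] using h1

theorem hasSum_covariance_logSq_sigma [IsProbabilityMeasure P]
    (hX : IsSFIEGARCH P α β s d ω θ γ Z σ X) (hd : d < 1 / 2)
    (t h : ℤ) :
    HasSum (fun k : ℤ => variance (gZ P Z θ γ 0) P *
      (extendZ (lamCoeff α β s d) k * extendZ (lamCoeff α β s d) (k + h)))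
      (covariance (logSq σ t) (logSq σ (t + h)) P) := by
  have e := (hX.logSq_sigma_expansion hd t).2.2 _ (hX.logSq_sigma_expansion hd (t + h)).1
  rw [hasSum_int_iff_of_neg fun n hn => by rw [extendZ_of_neg _ hn, zero_mul, mul_zero]]
  refine e.congr_fun fun k => ?_
  rw [covariance_comm, hX.covariance_logSq_sigma hd hX.memLp_gZ hX.covariance_gZ, extendZ_natCast,
    show t + h - 1 - (t - 1 - (k : ℤ)) = k + h by ring]
  ring

theorem isWeaklyStationary_logSq_sigma [IsProbabilityMeasure P]
    (hX : IsSFIEGARCH P α β s d ω θ γ Z σ X)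
    (hd : d < 1 / 2) : IsWeaklyStationary P (logSq σ) where
  memLp t := (hX.logSq_sigma_expansion hd t).1
  mean t := by rw [(hX.logSq_sigma_expansion hd t).2.1, (hX.logSq_sigma_expansion hd 0).2.1]
  cov t h := by
    have h0 := hX.hasSum_covariance_logSq_sigma hd 0 h
    rw [zero_add] at h0
    exact (hX.hasSum_covariance_logSq_sigma hd t h).unique h0

theorem hasSum_acvf_logSq_sigma [IsProbabilityMeasure P]
    (hX : IsSFIEGARCH P α β s d ω θ γ Z σ X) (hd : d < 1 / 2)
    (h : ℤ) (r : ℕ) :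
    HasSum (fun k : ℤ => gammaA α β ((s : ℤ) * k + (r : ℤ)) *
        gammaV s d (variance (gZ P Z θ γ 0) P) ((s : ℤ) * h - (s : ℤ) * k))
      (acvf P (logSq σ) ((s : ℤ) * h + (r : ℤ))) := by
  obtain ⟨T, h1, h2⟩ := exists_hasSum_lamCoeff_mul (α := α) hX.coeff_zero_beta hX.beta_ne_zero
    hX.s_pos hd ((s : ℤ) * h + r)
  have h3 := hX.hasSum_covariance_logSq_sigma hd 0 ((s : ℤ) * h + r)
  rw [zero_add] at h3
  rw [acvf, h3.unique (h1.mul_left _)]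
  refine hasSum_residue (A := gammaA α β) (W := gammaV s d (variance (gZ P Z θ γ 0) P)) hX.s_pos
    (fun n hn => if_neg hn) ?_
  refine (h2.mul_left (variance (gZ P Z θ γ 0) P)).congr_fun fun k => ?_
  rw [gammaV_eq_mul]
  ring

theorem logSq_X_ae_eq (hX : IsSFIEGARCH P α β s d ω θ γ Z σ X) (hZ0 : ∀ᵐ x ∂P, Z 0 x ≠ 0)
    (t : ℤ) : logSq X t =ᵐ[P] logSq σ t + logSq Z t := by
  have hZt : ∀ᵐ x ∂P, Z t x ≠ 0 :=
    (hX.ident_Z t).symm.ae_snd (p := fun y => y ≠ 0) (measurableSet_singleton 0).compl hZ0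
  filter_upwards [hX.X_eq t, hX.sigma_pos t, hZt] with x h1 h2 h3
  rw [Pi.add_apply, logSq, logSq, logSq, h1, mul_pow,
    Real.log_mul (pow_ne_zero 2 h2.ne') (pow_ne_zero 2 h3)]

theorem covariance_logSq_X [IsProbabilityMeasure P]
    (hX : IsSFIEGARCH P α β s d ω θ γ Z σ X) (hd : d < 1 / 2)
    (hZ0 : ∀ᵐ x ∂P, Z 0 x ≠ 0) (hvar : MemLp (logSq Z 0) 2 P) (t h : ℤ) :
    covariance (logSq X t) (logSq X (t + h)) P = acvf P (logSq σ) h +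
        (if h ≠ 0 then covariance (gZ P Z θ γ 0) (logSq Z 0) P *
          lamCoeff α β s d (h.natAbs - 1) else 0) +
        (if h = 0 then variance (logSq Z 0) P else 0) := by
  have hS := fun t => (hX.logSq_sigma_expansion hd t).1
  have hL := hX.memLp_logSq_Z hvar
  have hc := hX.covariance_logSq_sigma hd hL (hX.covariance_gZ_logSq_Z hvar)
  rw [covariance_congr_ae (hX.logSq_X_ae_eq hZ0 t) (hX.logSq_X_ae_eq hZ0 (t + h)),
    covariance_add_left (hS t) (hL t) ((hS _).add (hL _)),
    covariance_add_right (hS t) (hS _) (hL _), covariance_add_right (hL t) (hS _) (hL _),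
    (hX.isWeaklyStationary_logSq_sigma hd).cov, hc, covariance_comm (logSq Z t), hc,
    hX.covariance_logSq_Z hvar, ← acvf]
  -- The two cross covariances carry the indices `h - 1` and `-h - 1`: at most one is nonnegative,
  -- and neither is when `h = 0`.
  rcases lt_trichotomy h 0 with h0 | rfl | h0
  · rw [extendZ_of_neg _ (by omega : t + h - 1 - t < 0), if_neg (by omega), if_pos h0.ne,
      if_neg h0.ne, show t - 1 - (t + h) = ((h.natAbs - 1 : ℕ) : ℤ) by omega, extendZ_natCast]
    ring
  · rw [extendZ_of_neg _ (by omega : t + 0 - 1 - t < 0),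
      extendZ_of_neg _ (by omega : t - 1 - (t + 0) < 0)]
    simp
  · rw [extendZ_of_neg _ (by omega : t - 1 - (t + h) < 0), if_neg (by omega), if_pos h0.ne',
      if_neg h0.ne', show t + h - 1 - t = ((h.natAbs - 1 : ℕ) : ℤ) by omega, extendZ_natCast]
    ring

theorem acvf_logSq_X [IsProbabilityMeasure P]
    (hX : IsSFIEGARCH P α β s d ω θ γ Z σ X) (hd : d < 1 / 2)
    (hZ0 : ∀ᵐ x ∂P, Z 0 x ≠ 0) (hvar : MemLp (logSq Z 0) 2 P) (h : ℤ) :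
    acvf P (logSq X) h = acvf P (logSq σ) h +
        (if h ≠ 0 then covariance (gZ P Z θ γ 0) (logSq Z 0) P *
          lamCoeff α β s d (h.natAbs - 1) else 0) +
        (if h = 0 then variance (logSq Z 0) P else 0) := by
  have := hX.covariance_logSq_X hd hZ0 hvar 0 h
  rwa [zero_add] at this

theorem isWeaklyStationary_logSq_X [IsProbabilityMeasure P]
    (hX : IsSFIEGARCH P α β s d ω θ γ Z σ X) (hd : d < 1 / 2)
    (hZ0 : ∀ᵐ x ∂P, Z 0 x ≠ 0) (hvar : MemLp (logSq Z 0) 2 P) :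
    IsWeaklyStationary P (logSq X) where
  memLp t := (memLp_congr_ae (hX.logSq_X_ae_eq hZ0 t)).2
    ((hX.logSq_sigma_expansion hd t).1.add (hX.memLp_logSq_Z hvar t))
  mean t := by
    have key : ∀ t, ∫ x, logSq X t x ∂P = ω + ∫ x, logSq Z 0 x ∂P := fun t => by
      obtain ⟨h1, h2, -⟩ := hX.logSq_sigma_expansion hd t
      rw [integral_congr_ae (hX.logSq_X_ae_eq hZ0 t), ← hX.integral_logSq_Z t, ← h2]
      exact integral_add (h1.integrable one_le_two)
        ((hX.memLp_logSq_Z hvar t).integrable one_le_two)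
    rw [key, key]
  cov t h := by
    rw [hX.covariance_logSq_X hd hZ0 hvar t h]
    exact (hX.acvf_logSq_X hd hZ0 hvar h).symm

theorem lamCoeff_pred_isLittleO (hX : IsSFIEGARCH P α β s d ω θ γ Z σ X) (hd : d < 1 / 2)
    (ν : ℝ) {r : ℕ} (hr : r < s) :
    (fun h : ℕ => lamCoeff α β s d (s * h + r - 1) -
        seasCoeff s d (s * ((s * h + r - 1) / s)) * scrK α β s d (s * h + r - 1))
      =o[atTop] fun h : ℕ => (h : ℝ) ^ (-ν) := by
  have hs := hX.s_pos
  have key := fun {r : ℕ} (hr : r < s) => lamCoeff_sub_isLittleO (α := α) hX.coeff_zero_beta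
    hX.beta_ne_zero hs hd ν hr
  -- For `r ≥ 1` the index `sh + r - 1` stays in block `h`; for `r = 0` it is the last entry, `s -
  -- 1`, of block `h - 1`, and `(h-1)^(-ν) = O(h^(-ν))` absorbs the shift.
  rcases Nat.eq_zero_or_pos r with rfl | hr0
  · have h1 := (key (show s - 1 < s by omega)).comp_tendsto (tendsto_sub_atTop_nat 1)
    have h2 : (fun h : ℕ => ((h - 1 : ℕ) : ℝ) ^ (-ν)) =O[atTop] fun h : ℕ => (h : ℝ) ^ (-ν) := by
      have h3 : Tendsto (fun h : ℕ => (1 - 1 / (h : ℝ)) ^ (-ν)) atTop (𝓝 1) := by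
        have h := (tendsto_const_nhds (x := (1 : ℝ))).sub
          (tendsto_const_div_atTop_nhds_zero_nat (1 : ℝ))
        rw [sub_zero] at h
        simpa using h.rpow_const (p := -ν) (Or.inl one_ne_zero)
      refine ((h3.isBigO_one ℝ).mul (isBigO_refl (fun h : ℕ => (h : ℝ) ^ (-ν)) atTop)).congr'
        ?_ (.of_forall fun h => one_mul _)
      filter_upwards [eventually_ge_atTop 1] with h hh
      have hh1 : (1 : ℝ) ≤ h := by exact_mod_cast hh
      rw [Nat.cast_sub hh, Nat.cast_one, ← Real.mul_rpow _ (by linarith)]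
      · congr 1
        field_simp
      · rw [sub_nonneg, div_le_one (by linarith)]
        exact hh1
    refine (h1.trans_isBigO h2).congr' ?_ EventuallyEq.rfl
    filter_upwards [eventually_ge_atTop 1] with h hh
    obtain ⟨n, rfl⟩ := Nat.exists_eq_add_of_le' hh
    have e : s * (n + 1) + 0 - 1 = s * n + (s - 1) := by
      rw [mul_add]; omega
    simp only [Function.comp_apply, Nat.add_sub_cancel]
    rw [e, mul_add_div_of_lt (by omega)]
  · refine (key (show r - 1 < s by omega)).congr (fun h => ?_) fun h => rfl
    rw [Nat.add_sub_assoc hr0, mul_add_div_of_lt (by omega)]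

end IsSFIEGARCH

end SFIEGARCH

end

theorem mainTheorem7 {Ω : Type*} [MeasurableSpace Ω] (P : Measure Ω) [IsProbabilityMeasure P]
    (α β : Polynomial ℝ) (s : ℕ) (d ω θ γ : ℝ) (Z σ X : ℤ → Ω → ℝ)
    (hX : SFIEGARCH.IsSFIEGARCH P α β s d ω θ γ Z σ X)
    (hd : d < 1 / 2) (hθγ : ¬ (θ = 0 ∧ γ = 0))
    -- `ln Z_0²` is a.s. finite and has finite variance
    (hZ0 : ∀ᵐ x ∂P, Z 0 x ≠ 0)
    (hvar : MemLp (SFIEGARCH.logSq Z 0) 2 P) :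
    -- the autocovariance functions are well defined
    SFIEGARCH.IsWeaklyStationary P (SFIEGARCH.logSq σ) ∧
    SFIEGARCH.IsWeaklyStationary P (SFIEGARCH.logSq X) ∧
    -- the autocovariance function of `ln X_t²`
    (∀ h : ℤ,
      SFIEGARCH.acvf P (SFIEGARCH.logSq X) h =
        SFIEGARCH.acvf P (SFIEGARCH.logSq σ) h +
        (if h ≠ 0 then
          covariance (SFIEGARCH.gZ P Z θ γ 0) (SFIEGARCH.logSq Z 0) P *
            SFIEGARCH.lamCoeff α β s d (h.natAbs - 1)
        else 0) +
        (if h = 0 then variance (SFIEGARCH.logSq Z 0) P else 0)) ∧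
    -- the autocovariance function of `ln σ_t²`
    (∀ (h : ℤ) (r : ℕ), r < s →
      HasSum (fun k : ℤ => SFIEGARCH.gammaA α β ((s : ℤ) * k + (r : ℤ)) *
          SFIEGARCH.gammaV s d (variance (SFIEGARCH.gZ P Z θ γ 0) P) ((s : ℤ) * h - (s : ℤ) * k))
        (SFIEGARCH.acvf P (SFIEGARCH.logSq σ) ((s : ℤ) * h + (r : ℤ)))) ∧
    -- the asymptotic behaviour of the autocovariance function of `ln X_t²`
    (∀ ν : ℝ, 0 < ν → ∀ r : ℕ, r < s →
      (fun h : ℕ => SFIEGARCH.acvf P (SFIEGARCH.logSq X) ((s : ℤ) * (h : ℤ) + (r : ℤ)) -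
          (SFIEGARCH.gammaV s d (variance (SFIEGARCH.gZ P Z θ γ 0) P) ((s : ℤ) * (h : ℤ)) *
              SFIEGARCH.scrG α β s d (s * h + r) +
            covariance (SFIEGARCH.gZ P Z θ γ 0) (SFIEGARCH.logSq Z 0) P *
              SFIEGARCH.seasCoeff s d (s * ((s * h + r - 1) / s)) *
              SFIEGARCH.scrK α β s d (s * h + r - 1)))
        =o[atTop] (fun h : ℕ => (h : ℝ) ^ (-ν))) ∧
    -- the defining properties of `𝒢`
    (∀ ν : ℝ, 0 < ν → ∀ r : ℕ, r < s →
      (fun h : ℕ => SFIEGARCH.acvf P (SFIEGARCH.logSq σ) ((s : ℤ) * (h : ℤ) + (r : ℤ)) -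
          SFIEGARCH.gammaV s d (variance (SFIEGARCH.gZ P Z θ γ 0) P) ((s : ℤ) * (h : ℤ)) *
            SFIEGARCH.scrG α β s d (s * h + r))
        =o[atTop] (fun h : ℕ => (h : ℝ) ^ (-ν))) ∧
    Summable (SFIEGARCH.gammaA α β) ∧
    Tendsto (fun h : ℕ => ∑ r ∈ Finset.range s, SFIEGARCH.scrG α β s d (s * h + r)) atTop
      (𝓝 (∑' m : ℤ, SFIEGARCH.gammaA α β m)) ∧
    -- the defining properties of `𝒦`
    (∀ ν : ℝ, 0 < ν → ∀ r : ℕ, r < s →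
      (fun k : ℕ => SFIEGARCH.lamCoeff α β s d (s * k + r) -
          SFIEGARCH.seasCoeff s d (s * k) * SFIEGARCH.scrK α β s d (s * k + r))
        =o[atTop] (fun k : ℕ => (k : ℝ) ^ (-ν))) ∧
    Tendsto (fun k : ℕ => ∑ r ∈ Finset.range s, SFIEGARCH.scrK α β s d (s * k + r)) atTop
      (𝓝 (α.eval 1 / β.eval 1)) := by
  have hs := hX.s_pos
  have hβ0 := hX.coeff_zero_beta
  have hβ := hX.beta_ne_zero
  have hG := fun (ν : ℝ) {r : ℕ} (hr : r < s) =>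
    SFIEGARCH.autocov_sub_isLittleO hβ0 hβ hs hd _ ν (r := r)
      (fun h : ℕ => hX.hasSum_acvf_logSq_sigma hd h r) hr
  refine ⟨hX.isWeaklyStationary_logSq_sigma hd, hX.isWeaklyStationary_logSq_X hd hZ0 hvar,
    hX.acvf_logSq_X hd hZ0 hvar, fun h r _ => hX.hasSum_acvf_logSq_sigma hd h r,
    fun ν _ r hr => ?_, fun ν _ r hr => hG ν hr, (SFIEGARCH.geomDecay_gammaA α β hβ0 hβ).summable,
    SFIEGARCH.tendsto_sum_scrG hβ0 hβ hs d,
    fun ν _ r hr => SFIEGARCH.lamCoeff_sub_isLittleO hβ0 hβ hs hd ν hr,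
    SFIEGARCH.tendsto_sum_scrK hβ0 hβ hs d⟩
  refine ((hG ν hr).add ((hX.lamCoeff_pred_isLittleO hd ν hr).const_mul_left
    (covariance (SFIEGARCH.gZ P Z θ γ 0) (SFIEGARCH.logSq Z 0) P))).congr' ?_ EventuallyEq.rfl
  -- For `h ≥ 1` the lag `sh + r` is positive, so the lag-zero variance term is absent and the
  -- natural subtraction in `sh + r - 1` is not truncated.
  filter_upwards [eventually_ge_atTop 1] with h hh
  have hpos : 0 < s * h + r := Nat.add_pos_left (Nat.mul_pos hs hh) r
  have e : ((s : ℤ) * (h : ℤ) + (r : ℤ)) = ((s * h + r : ℕ) : ℤ) := by push_cast; rfl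
  have hne : ((s * h + r : ℕ) : ℤ) ≠ 0 := by exact_mod_cast hpos.ne'
  rw [hX.acvf_logSq_X hd hZ0 hvar, e, if_pos hne, if_neg hne, Int.natAbs_natCast]
  ring
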